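/- Let $G$ be a connected (finite-dimensional, real) Lie group with identity $e$ and Lie algebra $\mathfrak g=T_eG$, and let $\varphi=\{\varphi_t\}_{t\in\mathbb R}$ be a flow of automorphisms of $G$, that is, a (smooth) one-parameter group of automorphisms of $G$. The derivation $\mathcal D$ associated with $\varphi$ is determined by $(d\varphi_t)_e=\mathrm e^{t\mathcal D}$ for all $t\in\mathbb R$; the flow is called hyperbolic (resp. elliptic) if $\mathcal D$ is semisimple with only real (resp. purely imaginary) eigenvalues, and nilpotent if $\mathcal D$ is nilpotent. Let $$\varphi_t=\varphi^{\mathcal H}_t\circ\varphi^{\mathcal E}_t\circ\varphi^{\mathcal N}_t,\qquad t\in\mathbb R,$$ be the Jordan decomposition of $\varphi$ into commuting hyperbolic, elliptic and nilpotent flows of automorphisms, and let $\mathcal D_{\mathcal H}$ be the derivation associated with $\varphi^{\mathcal H}$. Put $G^0=\{g\in G:\varphi^{\mathcal H}_t(g)=g\ \text{for all }t\in\mathbb R\}$, and let $G^+$ and $G^-$ be the connected Lie subgroups of $G$ whose Lie algebras are the sums of the eigenspaces of $\mathcal D_{\mathcal H}$ for the positive and for the negative eigenvalues, respectively. The group $G$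 is called decomposable by $\varphi$ if $$G=(G^+G^0)G^-=(G^-G^0)G^+ .$$ For a topological group $H$ and a flow $\psi$ of automorphisms on $H$, a neighbourhood $U$ of the identity of $H$ and $\tau>0$, a $(U,\tau)$-chain from $x$ to $y$ consists of $n\ge 1$, points $x_0=x,x_1,\dots,x_n=y$ of $H$ and times $\tau_0,\dots,\tau_{n-1}\ge\tau$ such that $x_{i+1}^{-1}\psi_{\tau_i}(x_i)\in U$ for $i=0,\dots,n-1$. The chain recurrent set $\mathcal R_C(\psi)$ is the set of all $x\in H$ such that for every neighbourhood $U$ of the identity of $H$ and every $\tau>0$ there is a $(U,\tau)$-chain from $x$ to $x$. If $G$ is decomposable by $\varphi$, then $$\mathcal R_C(\varphi)=\mathcal R_C\left(\varphi|_{G^0}\right),$$ where $\varphi|_{G^0}$ is the restriction of $\varphi$ to the $\varphi$-invariant subgroup $G^0$, which carries the subspace topology. -/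

import Mathlib

open scoped Manifold ContDiff Pointwise Topology

noncomputable section

/-! ### Linear maps of the Lie algebra -/

section LinearMaps

variable {V : Type*} [AddCommGroup V] [Module ℝ V]

/-- Semisimple, and all complex eigenvalues are real. -/
def IsHyperbolicMap (D : Module.End ℝ V) : Prop :=
  D.IsSemisimple ∧
    ∀ z : ℂ, Module.End.HasEigenvalue (LinearMap.baseChange ℂ D) z → z.im = 0

/-- Semisimple, and all complex eigenvalues are purely imaginary (zero is allowed). -/
def IsEllipticMap (D : Module.End ℝ V) : Prop :=
  D.IsSemisimple ∧
    ∀ z : ℂ, Module.End.HasEigenvalue (LinearMap.baseChange ℂ D) z → z.re = 0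

/-- The sum of the eigenspaces of `D` for positive real eigenvalues. -/
def unstableSpace (D : Module.End ℝ V) : Submodule ℝ V :=
  ⨆ (l : ℝ) (_ : 0 < l), D.eigenspace l

/-- The sum of the eigenspaces of `D` for negative real eigenvalues. -/
def stableSpace (D : Module.End ℝ V) : Submodule ℝ V :=
  ⨆ (l : ℝ) (_ : l < 0), D.eigenspace l

end LinearMaps

/-! ### Chains -/

section Chains

variable {M : Type*} [Group M]

/-- `x 0, …, x n` and `t 0, …, t (n - 1)` form a `(U, τ)`-chain from `a` to `b` with `n ≥ 1` jumps
(the values of the sequences at larger indices play no role). -/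
structure IsJumpChain (φ : ℝ → M → M) (U : Set M) (τ : ℝ) (a b : M)
    (n : ℕ) (x : ℕ → M) (t : ℕ → ℝ) : Prop where
  pos : 1 ≤ n
  start : x 0 = a
  finish : x n = b
  time : ∀ i < n, τ ≤ t i
  jump : ∀ i < n, (x (i + 1))⁻¹ * φ (t i) (x i) ∈ U

/-- The points that can be reached from `a` by a `(U, τ)`-chain, for all neighbourhoods `U` of the
identity and all `τ > 0`. -/
def chainLimitSet [TopologicalSpace M] (φ : ℝ → M → M) (a : M) : Set M :=
  {b | ∀ U ∈ 𝓝 (1 : M), ∀ τ : ℝ, 0 < τ → ∃ n x t, IsJumpChain φ U τ a b n x t}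

/-- The chain recurrent set. -/
def chainRecurrentSet [TopologicalSpace M] (φ : ℝ → M → M) : Set M :=
  {a | a ∈ chainLimitSet φ a}

end Chains

/-! ### Flows of automorphisms of a Lie group -/

section Flows

variable (E : Type*) [NormedAddCommGroup E] [NormedSpace ℝ E]
  (G : Type*) [TopologicalSpace G] [ChartedSpace E G] [Group G]

/-- A flow of automorphisms of a Lie group `G` modelled on `E`: a smooth one-parameter group of
automorphisms. -/
structure AutFlow where
  toEquiv : ℝ → G ≃* G
  map_add : ∀ (s t : ℝ) (g : G), toEquiv (s + t) g = toEquiv s (toEquiv t g)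
  smooth : ContMDiff (𝓘(ℝ, ℝ).prod 𝓘(ℝ, E)) 𝓘(ℝ, E) ∞ (fun p : ℝ × G => toEquiv p.1 p.2)

variable {E G}

namespace AutFlow

instance : CoeFun (AutFlow E G) (fun _ => ℝ → G ≃* G) :=
  ⟨AutFlow.toEquiv⟩

/-- The flow all of whose maps are the identity. -/
def trivial : AutFlow E G where
  toEquiv _ := MulEquiv.refl G
  map_add _ _ _ := rfl
  smooth := contMDiff_snd

/-- The differential of `φ t` at the identity, as an endomorphism of the tangent space of `G` at
the identity, which is `E`. -/
def differential (φ : AutFlow E G) (t : ℝ) : E →L[ℝ] E :=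
  mfderiv 𝓘(ℝ, E) 𝓘(ℝ, E) (φ t) (1 : G)

/-- `D` is the derivation associated with `φ`: the differential of `φ t` at the identity is
`exp (t D)` for all `t`. -/
def HasDerivation (φ : AutFlow E G) (D : E →L[ℝ] E) : Prop :=
  ∀ t : ℝ, φ.differential t = NormedSpace.exp (t • D)

/-- The Jordan decomposition of a flow of automorphisms into commuting hyperbolic, elliptic and
nilpotent flows of automorphisms, together with their associated derivations. If `φ` has
derivation `D`, then `D = hypDer + ellDer + nilDer` is the additive Jordan decomposition of `D`. -/
structure JordanDecomposition (φ : AutFlow E G) where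
  (hyp ell nil : AutFlow E G)
  (hypDer ellDer nilDer : E →L[ℝ] E)
  hyp_der : hyp.HasDerivation hypDer
  ell_der : ell.HasDerivation ellDer
  nil_der : nil.HasDerivation nilDer
  hyp_hyperbolic : IsHyperbolicMap (hypDer : E →ₗ[ℝ] E)
  ell_elliptic : IsEllipticMap (ellDer : E →ₗ[ℝ] E)
  nil_nilpotent : IsNilpotent (nilDer : E →ₗ[ℝ] E)
  comm_hyp_ell : ∀ s t g, hyp s (ell t g) = ell t (hyp s g)
  comm_hyp_nil : ∀ s t g, hyp s (nil t g) = nil t (hyp s g)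
  comm_ell_nil : ∀ s t g, ell s (nil t g) = nil t (ell s g)
  eq_comp : ∀ t g, φ t g = hyp t (ell t (nil t g))

open Classical in
/-- The hyperbolic part of `φ`. On a connected Lie group every flow of automorphisms has exactly
one Jordan decomposition, so the second branch is never used there. -/
def hyperbolicPart (φ : AutFlow E G) : AutFlow E G :=
  if h : Nonempty φ.JordanDecomposition then h.some.hyp else trivial

open Classical in
/-- The derivation associated with the hyperbolic part of `φ`. -/
def hyperbolicDerivation (φ : AutFlow E G) : E →L[ℝ] E :=
  if h : Nonempty φ.JordanDecomposition then h.some.hypDer else 0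

/-- The central subgroup: the fixed points of the hyperbolic part. -/
def central (φ : AutFlow E G) : Subgroup G where
  carrier := {g | ∀ t, φ.hyperbolicPart t g = g}
  one_mem' t := map_one (φ.hyperbolicPart.toEquiv t)
  mul_mem' ha hb t := by rw [map_mul, ha t, hb t]
  inv_mem' ha t := by rw [map_inv, ha t]

end AutFlow

/-- The connected Lie subgroup of `G` that belongs to a subspace `𝔥` (a subalgebra) of the tangent
space at the identity: the subgroup generated by `exp 𝔥`, that is, by the values at time `1` of the
one-parameter subgroups of `G` whose initial velocity lies in `𝔥`. -/
def connectedSubgroup (𝔥 : Submodule ℝ E) : Subgroup G :=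
  Subgroup.closure {g : G | ∃ γ : ℝ → G,
    (∀ s t, γ (s + t) = γ s * γ t) ∧ ContMDiff 𝓘(ℝ, ℝ) 𝓘(ℝ, E) ∞ γ ∧
    (mfderiv 𝓘(ℝ, ℝ) 𝓘(ℝ, E) γ 0 (1 : ℝ) : E) ∈ 𝔥 ∧ γ 1 = g}

namespace AutFlow

/-- The unstable subgroup. -/
def unstable (φ : AutFlow E G) : Subgroup G :=
  connectedSubgroup (unstableSpace (φ.hyperbolicDerivation : E →ₗ[ℝ] E))

/-- The stable subgroup. -/
def stable (φ : AutFlow E G) : Subgroup G :=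
  connectedSubgroup (stableSpace (φ.hyperbolicDerivation : E →ₗ[ℝ] E))

/-- `G` is decomposable by `φ`: `G = (G⁺ G⁰) G⁻ = (G⁻ G⁰) G⁺`. -/
def Decomposes (φ : AutFlow E G) : Prop :=
  ((φ.unstable : Set G) * (φ.central : Set G)) * (φ.stable : Set G) = Set.univ ∧
    ((φ.stable : Set G) * (φ.central : Set G)) * (φ.unstable : Set G) = Set.univ

theorem hyperbolicPart_comm (φ : AutFlow E G) (s t : ℝ) (g : G) :
    φ.hyperbolicPart s (φ t g) = φ t (φ.hyperbolicPart s g) := by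
  unfold hyperbolicPart
  split_ifs with h
  · have hh : ∀ g, h.some.hyp s (h.some.hyp t g) = h.some.hyp t (h.some.hyp s g) := fun g => by
      rw [← h.some.hyp.map_add, ← h.some.hyp.map_add, add_comm]
    rw [h.some.eq_comp, h.some.eq_comp, hh, h.some.comm_hyp_ell, h.some.comm_hyp_nil]
  · rfl

theorem map_mem_central (φ : AutFlow E G) (t : ℝ) {g : G} (hg : g ∈ φ.central) :
    φ t g ∈ φ.central := fun s => by
  rw [hyperbolicPart_comm, hg s]

/-- The restriction of `φ` to the central subgroup. -/
def restrictCentral (φ : AutFlow E G) : ℝ → φ.central → φ.central :=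
  fun t g => ⟨φ t g, φ.map_mem_central t g.2⟩

end AutFlow

end Flows

end

/-!
Write `H` for the hyperbolic part of `φ`, `D` for its derivation, and `V x = d/dt|₀ (x⁻¹ * H t x)`
for the left translated velocity of `H`. The map `V` is a continuous cocycle,
`V (x * y) = Ad (y⁻¹) (V x) + V y`, it is intertwined by the differentials of `φ`, and it vanishes
exactly at the fixed points of `H`. Where the `H`-orbit of `x` converges, `V x` is contracted by
`exp (t D)`; decomposability yields the converse, so that `G⁰G⁻`, and by time reversal `G⁰G⁺`, are
closed subgroups cut out by `V`. By the open mapping theorem the factorization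
`G = (G⁺G⁰)G⁻` is then topological near the identity. The elliptic and nilpotent parts grow
subexponentially, so `φ` contracts `G⁻`, and a contracted factor is invisible to chain recurrence:
the chain recurrent set of `φ` lies in `G⁺G⁰` and is that of the restriction. Running time backwards
removes `G⁺` in the same way.
-/

noncomputable section

section Chains

open Relation Filter Set

variable {M : Type*} [Group M]

namespace IsJumpChain

variable {φ : ℝ → M → M} {U : Set M} {τ : ℝ} {a b : M} {n : ℕ} {x : ℕ → M} {t : ℕ → ℝ}

theorem single {s : ℝ} (hs : τ ≤ s) (hj : b⁻¹ * φ s a ∈ U) :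
    IsJumpChain φ U τ a b 1 (fun i => if i = 0 then a else b) fun _ => s where
  pos := le_rfl
  start := by simp
  finish := by simp
  time _ _ := hs
  jump i hi := by
    obtain rfl : i = 0 := by omega
    simpa using hj

theorem snoc (h : IsJumpChain φ U τ a b n x t) {s : ℝ} {c : M} (hs : τ ≤ s)
    (hj : c⁻¹ * φ s b ∈ U) :
    IsJumpChain φ U τ a c (n + 1) (fun i => if i ≤ n then x i else c)
      fun i => if i < n then t i else s where
  pos := by omega
  start := by simp [h.start]
  finish := by simp
  time i _ := by
    split_ifs with hin
    exacts [h.time i hin, hs]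
  jump i hi := by
    rcases Nat.lt_succ_iff_lt_or_eq.mp hi with hin | rfl
    · simpa [hin, hin.le, Nat.succ_le_iff] using h.jump i hin
    · simpa [h.finish] using hj

end IsJumpChain

/-- One jump of a chain that stays in `K`, with a time in `I` and an error in `U`. -/
def ChainStep (φ : ℝ → M → M) (K U : Set M) (I : Set ℝ) (x y : M) : Prop :=
  x ∈ K ∧ y ∈ K ∧ ∃ t ∈ I, y⁻¹ * φ t x ∈ U

theorem ChainStep.mono {φ : ℝ → M → M} {K L U V : Set M} {I J : Set ℝ} {x y : M}
    (hKL : K ⊆ L) (hUV : U ⊆ V) (hIJ : I ⊆ J) (h : ChainStep φ K U I x y) :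
    ChainStep φ L V J x y :=
  let ⟨hx, hy, t, ht, hj⟩ := h
  ⟨hKL hx, hKL hy, t, hIJ ht, hUV hj⟩

theorem IsJumpChain.transGen_chainStep {φ : ℝ → M → M} {U : Set M} {τ : ℝ} {a b : M} {n : ℕ}
    {x : ℕ → M} {t : ℕ → ℝ} (h : IsJumpChain φ U τ a b n x t) :
    TransGen (ChainStep φ univ U (Ici τ)) a b := by
  have hsteps : TransGen (fun i j => ChainStep φ univ U (Ici τ) (x i) (x j)) 0 n :=
    transGen_of_succ_of_lt _ (fun i hi =>
      ⟨mem_univ _, mem_univ _, t i, h.time i hi.2, h.jump i hi.2⟩) h.pos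
  rw [← h.start, ← h.finish]
  exact hsteps.lift x fun _ _ => id

theorem exists_isJumpChain_iff_transGen (φ : ℝ → M → M) (U : Set M) (τ : ℝ) (a b : M) :
    (∃ n x t, IsJumpChain φ U τ a b n x t) ↔ TransGen (ChainStep φ univ U (Ici τ)) a b := by
  refine ⟨fun ⟨_, _, _, h⟩ => h.transGen_chainStep, fun h => ?_⟩
  induction h with
  | single hstep =>
    obtain ⟨-, -, t, ht, hj⟩ := hstep
    exact ⟨1, _, _, .single ht hj⟩
  | tail _ hstep ih =>
    obtain ⟨-, -, s, hs, hj⟩ := hstep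
    obtain ⟨n, x, t, hchain⟩ := ih
    exact ⟨n + 1, _, _, hchain.snoc hs hj⟩

theorem ChainStep.transGen_bounded_time {φ : ℝ → M → M}
    (hadd : ∀ s t x, φ (s + t) x = φ s (φ t x)) {K U : Set M} (hK : ∀ t, MapsTo (φ t) K K)
    (hU : 1 ∈ U) {τ : ℝ} (hτ : 0 < τ) {x y : M} (h : ChainStep φ K U (Ici τ) x y) :
    TransGen (ChainStep φ K U (Icc τ (2 * τ))) x y := by
  obtain ⟨hx, hy, t, ht, hj⟩ := h
  obtain ⟨n, hn⟩ := exists_nat_ge (t / τ)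
  rw [div_le_iff₀ hτ] at hn
  induction n generalizing x t with
  | zero => linarith [mem_Ici.1 ht, hn.trans_eq (by simp : ((0 : ℕ) : ℝ) * τ = 0)]
  | succ n ih =>
    by_cases ht2 : t ≤ 2 * τ
    · exact .single ⟨hx, hy, t, ⟨ht, ht2⟩, hj⟩
    · have hfirst : ChainStep φ K U (Icc τ (2 * τ)) x (φ τ x) :=
        ⟨hx, hK τ hx, τ, ⟨le_rfl, by linarith⟩, by simpa using hU⟩
      push_cast at hn
      refine .head hfirst (ih (hK τ hx) (t - τ) (mem_Ici.2 (by linarith)) ?_ (by linarith))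
      rwa [← hadd, sub_add_cancel]

section Recurrence

variable [TopologicalSpace M]

/-- The point `a` is chain recurrent by chains that stay in `K`. -/
def ChainRecurrentIn (φ : ℝ → M → M) (K : Set M) (a : M) : Prop :=
  ∀ U ∈ 𝓝 (1 : M), ∀ τ : ℝ, 0 < τ → TransGen (ChainStep φ K U (Ici τ)) a a

theorem mem_chainRecurrentSet_iff {φ : ℝ → M → M} {a : M} :
    a ∈ chainRecurrentSet φ ↔ ChainRecurrentIn φ univ a := by
  simp only [chainRecurrentSet, chainLimitSet, mem_ofPred_eq, exists_isJumpChain_iff_transGen,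
    ChainRecurrentIn]

namespace ChainRecurrentIn

theorem mem {φ : ℝ → M → M} {K : Set M} {a : M} (h : ChainRecurrentIn φ K a) : a ∈ K := by
  obtain ⟨_, ⟨ha, -⟩, -⟩ := TransGen.head'_iff.1 (h univ univ_mem 1 one_pos)
  exact ha

theorem mono {φ : ℝ → M → M} {K L : Set M} (hKL : K ⊆ L) {a : M} (h : ChainRecurrentIn φ K a) :
    ChainRecurrentIn φ L a := fun U hU τ hτ =>
  TransGen.mono (fun _ _ => ChainStep.mono hKL le_rfl le_rfl) _ _ (h U hU τ hτ)

theorem mem_image_chainRecurrentSet {φ : ℝ → M → M} {K : Subgroup M} {ψ : ℝ → K → K}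
    (hψ : ∀ t x, (ψ t x : M) = φ t x) {a : M} (h : ChainRecurrentIn φ K a) :
    a ∈ Subtype.val '' chainRecurrentSet ψ := by
  refine ⟨⟨a, h.mem⟩, mem_chainRecurrentSet_iff.2 fun U hU τ hτ => ?_, rfl⟩
  obtain ⟨V, hV, hVU⟩ := (mem_nhds_subtype (K : Set M) 1 U).1 hU
  have lift_step : ∀ x y : K, ChainStep φ K V (Ici τ) x y → ChainStep ψ univ U (Ici τ) x y := by
    rintro x y ⟨-, -, t, ht, hj⟩
    exact ⟨mem_univ _, mem_univ _, t, ht, hVU (by simpa [hψ] using hj)⟩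
  have lift_chain : ∀ b, TransGen (ChainStep φ K V (Ici τ)) a b →
      ∃ hb : b ∈ K, TransGen (ChainStep ψ univ U (Ici τ)) ⟨a, h.mem⟩ ⟨b, hb⟩ := by
    intro b hb
    induction hb with
    | single hstep => exact ⟨hstep.2.1, .single (lift_step _ ⟨_, hstep.2.1⟩ hstep)⟩
    | tail _ hstep ih => exact ⟨hstep.2.1, ih.2.tail (lift_step ⟨_, ih.1⟩ ⟨_, hstep.2.1⟩ hstep)⟩
  exact (lift_chain a (h V hV τ hτ)).2

end ChainRecurrentIn

theorem mem_image_chainRecurrentSet_iff {φ : ℝ → M → M} {K : Subgroup M} {ψ : ℝ → K → K}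
    (hψ : ∀ t x, (ψ t x : M) = φ t x) {a : M} :
    a ∈ Subtype.val '' chainRecurrentSet ψ ↔ ChainRecurrentIn φ K a := by
  refine ⟨?_, ChainRecurrentIn.mem_image_chainRecurrentSet hψ⟩
  rintro ⟨a, ha, rfl⟩ U hU τ hτ
  have hU' : Subtype.val ⁻¹' U ∈ 𝓝 (1 : K) :=
    continuous_subtype_val.continuousAt.preimage_mem_nhds (by simpa using hU)
  refine (mem_chainRecurrentSet_iff.1 ha _ hU' τ hτ).lift Subtype.val ?_
  rintro x y ⟨-, -, t, ht, hj⟩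
  exact ⟨x.2, y.2, t, ht, by simpa [hψ] using hj⟩

variable [IsTopologicalGroup M] {F : Type*} [FunLike F M M] [MonoidHomClass F M M] {ψ : ℝ → F}

/-- Jumps whose times stay in a compact interval can be reversed at the cost of a controlled
change of the error. -/
theorem ChainRecurrentIn.reverse (hadd : ∀ s t x, ψ (s + t) x = ψ s (ψ t x)) (h0 : ∀ x, ψ 0 x = x)
    (hcont : Continuous fun p : ℝ × M => ψ p.1 p.2) {K : Set M} (hK : ∀ t, MapsTo (ψ t) K K)
    {a : M} (h : ChainRecurrentIn (fun t => ψ t) K a) :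
    ChainRecurrentIn (fun t => ψ (-t)) K a := by
  intro U hU τ hτ
  have hV : ∀ᶠ u in 𝓝 (1 : M), ∀ t ∈ Icc τ (2 * τ), ψ (-t) u⁻¹ ∈ U := by
    refine isCompact_Icc.eventually_forall_of_forall_eventually fun t _ => ?_
    have hc : Continuous fun p : M × ℝ => ψ (-p.2) p.1⁻¹ :=
      hcont.comp (f := fun p : M × ℝ => (-p.2, p.1⁻¹)) (by fun_prop)
    exact hc.continuousAt.eventually_mem (by simpa using hU)
  rw [← transGen_swap]
  refine TransGen.lift' id (fun x y hxy => ?_) _ _ (h _ hV τ hτ)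
  refine TransGen.mono ?_ _ _ (hxy.transGen_bounded_time hadd hK (mem_of_mem_nhds hV) hτ)
  rintro x y ⟨hx, hy, t, ht, hj⟩
  have hjt := hj t ht
  rw [mul_inv_rev, inv_inv, map_mul, map_inv, ← hadd, neg_add_cancel, h0] at hjt
  exact ⟨hy, hx, t, ht.1, hjt⟩

end Recurrence

section Contraction

variable {F : Type*} [FunLike F M M] [MonoidHomClass F M M] {ψ : ℝ → F}

/-- The `Q`-components of the points of a chain in `K` form a chain. -/
theorem exists_transGen_chainStep_left {K Q P : Subgroup M} (hQ : ∀ t, MapsTo (ψ t) Q Q)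
    {U V W : Set M} {I : Set ℝ} (hUV : U ⊆ V)
    (hW : ∀ q ∈ Q, ∀ z ∈ W, ∀ y ∈ K, y⁻¹ * (q * z) ∈ W →
      ∃ q' ∈ Q, ∃ p ∈ P, p ∈ U ∧ q' * p = y ∧ q'⁻¹ * q ∈ U)
    (hI : ∀ t ∈ I, MapsTo (ψ t) (P ∩ V) W) {q₀ p₀ : M} (hq₀ : q₀ ∈ Q) (hp₀ : p₀ ∈ (P : Set M) ∩ V)
    {y : M} (hy : TransGen (ChainStep (fun t => ψ t) K W I) (q₀ * p₀) y) :
    ∃ q ∈ Q, ∃ p ∈ P, p ∈ U ∧ q * p = y ∧ TransGen (ChainStep (fun t => ψ t) Q U I) q₀ q := by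
  have project_step : ∀ q ∈ Q, ∀ p ∈ (P : Set M) ∩ V, ∀ y,
      ChainStep (fun t => ψ t) K W I (q * p) y →
      ∃ q' ∈ Q, ∃ p' ∈ P, p' ∈ U ∧ q' * p' = y ∧ ChainStep (fun t => ψ t) Q U I q q' := by
    rintro q hq p hp y ⟨-, hy, t, ht, (hj : y⁻¹ * ψ t (q * p) ∈ W)⟩
    rw [map_mul] at hj
    obtain ⟨q', hq', p', hp', hpU, hqp, hqU⟩ := hW _ (hQ t hq) _ (hI t ht hp) y hy hj
    exact ⟨q', hq', p', hp', hpU, hqp, hq, hq', t, ht, hqU⟩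
  induction hy with
  | single hstep =>
    obtain ⟨q, hq, p, hp, hpU, hqp, hqstep⟩ := project_step q₀ hq₀ p₀ hp₀ _ hstep
    exact ⟨q, hq, p, hp, hpU, hqp, .single hqstep⟩
  | tail _ hstep ih =>
    obtain ⟨q, hq, p, hp, hpU, rfl, hchain⟩ := ih
    obtain ⟨q', hq', p', hp', hpU', hqp', hqstep⟩ := project_step q hq p ⟨hp, hUV hpU⟩ _ hstep
    exact ⟨q', hq', p', hp', hpU', hqp', hchain.tail hqstep⟩

variable [TopologicalSpace M]

/-- `K` is the product of its subgroup `Q` and of `P`, which meet in `1` only, and the two factors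
of a point of `K` that is close to `1` are close to `1`. -/
structure IsTopSplit (K Q P : Subgroup M) : Prop where
  left_le : Q ≤ K
  disjoint : Disjoint Q P
  subset_mul : (K : Set M) ⊆ Q * P
  nhdsWithin_le : 𝓝[(K : Set M)] 1 ≤ 𝓝[(Q : Set M)] 1 * 𝓝[(P : Set M)] 1

/-- As time goes to infinity, `ψ` contracts `P` to `1`, uniformly on neighbourhoods of `1` that
are large enough to contain any given point of `P`. -/
def ContractsToOne (ψ : ℝ → M → M) (P : Set M) : Prop :=
  ∀ p ∈ P, ∃ V ∈ 𝓝 (1 : M), p ∈ V ∧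
    Tendsto (fun q : ℝ × M => ψ q.1 q.2) (atTop ×ˢ 𝓟 (P ∩ V)) (𝓝 1)

variable [IsTopologicalGroup M] {K Q P : Subgroup M}

theorem IsTopSplit.exists_nhds_mul_mem (h : IsTopSplit K Q P) {U : Set M} (hU : U ∈ 𝓝 (1 : M)) :
    ∃ W ∈ 𝓝 (1 : M), ∀ q ∈ Q, ∀ z ∈ W, ∀ y ∈ K, y⁻¹ * (q * z) ∈ W →
      ∃ q' ∈ Q, ∃ p ∈ P, p ∈ U ∧ q' * p = y ∧ q'⁻¹ * q ∈ U := by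
  have hUinv : U⁻¹ ∈ 𝓝 (1 : M) := inv_mem_nhds_one M hU
  obtain ⟨S, hS, hSK⟩ := mem_nhdsWithin_iff_exists_mem_nhds_inter.1 <| h.nhdsWithin_le <|
    mul_mem_mul (inter_mem_nhdsWithin (Q : Set M) hUinv) (inter_mem_nhdsWithin (P : Set M) hU)
  obtain ⟨W, hW, hWS⟩ := exists_nhds_split_inv hS
  refine ⟨W, hW, fun q hq z hz y hy hyW => ?_⟩
  have herr : z / (y⁻¹ * (q * z)) = q⁻¹ * y := by
    rw [div_eq_mul_inv]; group
  have hS : q⁻¹ * y ∈ S := herr ▸ hWS z hz _ hyW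
  have hK : q⁻¹ * y ∈ K := K.mul_mem (K.inv_mem (h.left_le hq)) hy
  obtain ⟨r, ⟨hrQ, hrU⟩, p, ⟨hpP, hpU⟩, hrp : r * p = q⁻¹ * y⟩ := hSK ⟨hS, hK⟩
  refine ⟨q * r, Q.mul_mem hq hrQ, p, hpP, hpU, ?_, ?_⟩
  · rw [mul_assoc, hrp, mul_inv_cancel_left]
  · simpa using hrU

theorem ChainRecurrentIn.of_contractsToOne [T1Space M] (hsplit : IsTopSplit K Q P)
    (hQ : ∀ t, MapsTo (ψ t) Q Q) (hP : ContractsToOne (fun t => ψ t) (P : Set M)) {a : M}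
    (h : ChainRecurrentIn (fun t => ψ t) K a) : ChainRecurrentIn (fun t => ψ t) Q a := by
  obtain ⟨q₀, hq₀, p₀, hp₀, rfl⟩ := hsplit.subset_mul h.mem
  obtain ⟨V, hV, hp₀V, hcontr⟩ := hP p₀ hp₀
  have main : ∀ U ∈ 𝓝 (1 : M), ∀ τ : ℝ, 0 < τ →
      p₀ ∈ U ∧ TransGen (ChainStep (fun t => ψ t) Q U (Ici τ)) q₀ q₀ := by
    intro U hU τ hτ
    obtain ⟨W, hW, hWUV⟩ := hsplit.exists_nhds_mul_mem (inter_mem hU hV)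
    obtain ⟨T, hT⟩ := eventually_atTop.1 (eventually_prod_principal_iff.1 (hcontr hW))
    have hchainK := h W hW (max τ T) (lt_max_of_lt_left hτ)
    obtain ⟨q, hq, p, hp, hpUV, hqp, hchainQ⟩ := exists_transGen_chainStep_left hQ
      inter_subset_right hWUV (fun t ht => hT t (le_of_max_le_right ht)) hq₀ ⟨hp₀, hp₀V⟩ hchainK
    obtain ⟨rfl, rfl⟩ : q = q₀ ∧ p = p₀ := by
      simpa using Subgroup.mul_injective_of_disjoint hsplit.disjoint
        (a₁ := (⟨q, hq⟩, ⟨p, hp⟩)) (a₂ := (⟨q₀, hq₀⟩, ⟨p₀, hp₀⟩)) hqp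
    exact ⟨hpUV.1, TransGen.mono (fun _ _ =>
      ChainStep.mono le_rfl inter_subset_left (Ici_subset_Ici.2 (le_max_left τ T))) _ _ hchainQ⟩
  have hp₀1 : p₀ = 1 := (specializes_iff_pure.2 fun U hU => (main U hU 1 one_pos).1).eq
  subst hp₀1
  simp only [mul_one]
  exact fun U hU τ hτ => (main U hU τ hτ).2

end Contraction

end Chains

section LinearFlows

open Filter NormedSpace TensorProduct

section NormedAlgebra

variable {𝔸 : Type*} [NormedRing 𝔸] [NormedAlgebra ℝ 𝔸]

theorem exp_add_smul [CompleteSpace 𝔸] (s t : ℝ) (a : 𝔸) :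
    exp ((s + t) • a) = exp (s • a) * exp (t • a) := by
  let +nondep : NormedAlgebra ℚ 𝔸 := .restrictScalars ℚ ℝ 𝔸
  rw [add_smul]
  exact exp_add_of_commute ((Commute.refl a).smul_left s |>.smul_right t)

theorem exists_norm_exp_smul_le_of_isNilpotent {a : 𝔸} (ha : IsNilpotent a) {c : ℝ} (hc : 0 < c) :
    ∃ C, ∀ t : ℝ, ‖exp (t • a)‖ ≤ C * Real.exp (c * |t|) := by
  obtain ⟨n, hn⟩ := ha
  refine ⟨∑ k ∈ Finset.range n, ‖a ^ k‖ / c ^ k, fun t => ?_⟩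
  have hvanish : ∀ k ∉ Finset.range n, (k.factorial : ℝ)⁻¹ • (t • a) ^ k = 0 := fun k hk => by
    rw [smul_pow, pow_eq_zero_of_le (by simpa using hk) hn, smul_zero, smul_zero]
  simp only [exp_eq_tsum ℝ]
  rw [tsum_eq_sum hvanish, Finset.sum_mul]
  refine norm_sum_le_of_le _ fun k _ => ?_
  calc ‖(k.factorial : ℝ)⁻¹ • (t • a) ^ k‖
      = ‖a ^ k‖ / c ^ k * ((c * |t|) ^ k / k.factorial) := by
        rw [smul_pow, norm_smul, norm_smul, norm_inv, norm_pow, Real.norm_eq_abs,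
          Real.norm_eq_abs, Nat.abs_cast, mul_pow]
        field_simp
    _ ≤ ‖a ^ k‖ / c ^ k * Real.exp (c * |t|) := by
        gcongr
        exact Real.pow_div_factorial_le_exp _ (by positivity) k

end NormedAlgebra

variable {E : Type*} [NormedAddCommGroup E] [NormedSpace ℝ E]

/-- The vectors that the linear flow `exp (t D)` contracts to zero. -/
def contractingSpace (D : E →L[ℝ] E) : Submodule ℝ E where
  carrier := {w | Tendsto (fun t : ℝ => exp (t • D) w) atTop (𝓝 0)}
  zero_mem' := by simp
  add_mem' ha hb := by simpa using Tendsto.add ha hb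
  smul_mem' c w hw := by simpa using Tendsto.const_smul hw c

theorem mem_contractingSpace {D : E →L[ℝ] E} {w : E} :
    w ∈ contractingSpace D ↔ Tendsto (fun t : ℝ => exp (t • D) w) atTop (𝓝 0) :=
  Iff.rfl

section Complete

variable [CompleteSpace E]

theorem exp_add_smul_apply (s t : ℝ) (D : E →L[ℝ] E) (w : E) :
    exp ((s + t) • D) w = exp (s • D) (exp (t • D) w) :=
  DFunLike.congr_fun (exp_add_smul s t D) w

theorem hasDerivAt_exp_smul_apply (D : E →L[ℝ] E) (w : E) (t : ℝ) :
    HasDerivAt (fun s : ℝ => exp (s • D) w) (exp (t • D) (D w)) t := by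
  simpa using (hasDerivAt_exp_smul_const D t).clm_apply (hasDerivAt_const t w)

theorem hasDerivAt_exp_smul_apply' (D : E →L[ℝ] E) (w : E) (t : ℝ) :
    HasDerivAt (fun s : ℝ => exp (s • D) w) (D (exp (t • D) w)) t := by
  simpa using (hasDerivAt_exp_smul_const' D t).clm_apply (hasDerivAt_const t w)

theorem exp_smul_mem_contractingSpace {D : E →L[ℝ] E} {w : E} (hw : w ∈ contractingSpace D)
    (s : ℝ) : exp (s • D) w ∈ contractingSpace D := by
  simp only [mem_contractingSpace, ← exp_add_smul_apply]
  exact (mem_contractingSpace.1 hw).comp (tendsto_atTop_add_const_right _ s tendsto_id)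

theorem norm_exp_nat_mul_smul_le {D : E →L[ℝ] E} {T r : ℝ} (hr : 0 ≤ r)
    (hT : ∀ w ∈ contractingSpace D, ‖exp (T • D) w‖ ≤ r * ‖w‖) (n : ℕ) :
    ∀ w ∈ contractingSpace D, ‖exp ((n * T) • D) w‖ ≤ r ^ n * ‖w‖ := by
  induction n with
  | zero => simp
  | succ n ih =>
    intro w hw
    calc ‖exp (((n + 1 : ℕ) * T) • D) w‖ = ‖exp ((n * T) • D) (exp (T • D) w)‖ := by
          rw [← exp_add_smul_apply, Nat.cast_succ, add_one_mul]
      _ ≤ r ^ n * ‖exp (T • D) w‖ := ih _ (exp_smul_mem_contractingSpace hw T)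
      _ ≤ r ^ n * (r * ‖w‖) := by gcongr; exact hT w hw
      _ = r ^ (n + 1) * ‖w‖ := by ring

theorem exp_smul_apply_of_mem_eigenspace {D : E →L[ℝ] E} {l : ℝ} {w : E}
    (hw : w ∈ Module.End.eigenspace (D : E →ₗ[ℝ] E) l) (t : ℝ) :
    exp (t • D) w = Real.exp (l * t) • w := by
  have hD : D w = l • w := Module.End.mem_eigenspace_iff.1 hw
  have hexp (s : ℝ) : HasDerivAt (fun s => Real.exp (l * s) • w) (D (Real.exp (l * s) • w)) s := by
    have hscalar := ((hasDerivAt_id s).const_mul l).exp.smul_const w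
    simpa [hD, smul_smul] using hscalar
  exact congrFun (ODE_solution_unique_univ (v := fun _ => D) (s := fun _ => Set.univ) (t₀ := 0)
    (fun _ => D.lipschitz.lipschitzOnWith)
    (fun s => ⟨hasDerivAt_exp_smul_apply' D w s, Set.mem_univ _⟩)
    (fun s => ⟨hexp s, Set.mem_univ _⟩) (by simp)) t

theorem stableSpace_le_contractingSpace (D : E →L[ℝ] E) :
    stableSpace (D : E →ₗ[ℝ] E) ≤ contractingSpace D := by
  refine iSup₂_le fun l hl w hw => ?_
  simp only [mem_contractingSpace, exp_smul_apply_of_mem_eigenspace hw]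
  have hdecay : Tendsto (fun t : ℝ => Real.exp (l * t)) atTop (𝓝 0) :=
    Real.tendsto_exp_atBot.comp (tendsto_id.const_mul_atTop_of_neg hl)
  simpa using hdecay.smul_const w

theorem unstableSpace_le_contractingSpace (D : E →L[ℝ] E) :
    unstableSpace (D : E →ₗ[ℝ] E) ≤ contractingSpace (-D) := by
  refine iSup₂_le fun l hl w hw => stableSpace_le_contractingSpace (-D) ?_
  refine Submodule.mem_iSup_of_mem (-l) (Submodule.mem_iSup_of_mem (neg_lt_zero.2 hl) ?_)
  rw [Module.End.mem_eigenspace_iff] at hw ⊢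
  simpa using hw

end Complete

section ComplexCoefficients

variable {D : E →L[ℝ] E}

/-- The matrix coefficient `v ↦ ξ (exp (t D) v)` of the linear flow of `D`, extended to a complex
linear form on the complexification, where `D` may have eigenvectors. -/
def complexCoeff (D : E →L[ℝ] E) (ξ : StrongDual ℝ E) (t : ℝ) : ℂ ⊗[ℝ] E →ₗ[ℂ] ℂ :=
  (AlgebraTensorModule.rid ℝ ℂ ℂ).toLinearMap ∘ₗ
    LinearMap.baseChange ℂ (ξ.comp (exp (t • D)) : E →ₗ[ℝ] ℝ)

theorem complexCoeff_tmul (ξ : StrongDual ℝ E) (t : ℝ) (a : ℂ) (v : E) :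
    complexCoeff D ξ t (a ⊗ₜ v) = ξ (exp (t • D) v) • a := by
  simp [complexCoeff]

theorem hasDerivAt_complexCoeff [CompleteSpace E] (ξ : StrongDual ℝ E) (z : ℂ ⊗[ℝ] E) (t : ℝ) :
    HasDerivAt (fun s => complexCoeff D ξ s z)
      (complexCoeff D ξ t (LinearMap.baseChange ℂ (D : E →ₗ[ℝ] E) z)) t := by
  induction z with
  | zero => simpa using hasDerivAt_const t (0 : ℂ)
  | tmul a v =>
    simp only [LinearMap.baseChange_tmul, complexCoeff_tmul]
    exact (ξ.hasFDerivAt.comp_hasDerivAt t (hasDerivAt_exp_smul_apply D v t)).smul_const a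
  | add x y hx hy => simpa only [map_add] using hx.fun_add hy

theorem complexCoeff_of_mem_eigenspace [CompleteSpace E] (ξ : StrongDual ℝ E) {μ : ℂ}
    {z : ℂ ⊗[ℝ] E}
    (hz : z ∈ Module.End.eigenspace (LinearMap.baseChange ℂ (D : E →ₗ[ℝ] E)) μ) (t : ℝ) :
    complexCoeff D ξ t z = Complex.exp (μ * t) * complexCoeff D ξ 0 z := by
  have hcoeff (s : ℝ) :
      HasDerivAt (fun s => complexCoeff D ξ s z) (μ * complexCoeff D ξ s z) s := by
    simpa [Module.End.mem_eigenspace_iff.1 hz] using hasDerivAt_complexCoeff (D := D) ξ z s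
  have hexp (s : ℝ) : HasDerivAt (fun s : ℝ => Complex.exp (μ * s) * complexCoeff D ξ 0 z)
      (μ * (Complex.exp (μ * s) * complexCoeff D ξ 0 z)) s := by
    have hscalar := ((Complex.ofRealCLM.hasDerivAt (x := s)).const_mul μ).cexp.mul_const
      (complexCoeff D ξ 0 z)
    exact hscalar.congr_deriv (by simp; ring)
  exact congrFun (ODE_solution_unique_univ (v := fun _ => (μ * ·)) (s := fun _ => Set.univ)
    (t₀ := 0) (fun _ => (lipschitzWith_smul μ).lipschitzOnWith)
    (fun s => ⟨hcoeff s, Set.mem_univ _⟩) (fun s => ⟨hexp s, Set.mem_univ _⟩) (by simp)) t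

end ComplexCoefficients

theorem one_half_pow_floor_le (x : ℝ) :
    (1 / 2 : ℝ) ^ ⌊x⌋₊ ≤ 2 * Real.exp (-(Real.log 2 * x)) := by
  calc (1 / 2 : ℝ) ^ ⌊x⌋₊ = Real.exp (-(Real.log 2 * ⌊x⌋₊)) := by
        rw [Real.exp_neg, mul_comm, Real.exp_nat_mul, Real.exp_log two_pos, one_div, inv_pow]
    _ ≤ Real.exp (Real.log 2 + -(Real.log 2 * x)) := by
        rw [Real.exp_le_exp]
        nlinarith [Nat.lt_floor_add_one x, Real.log_pos one_lt_two]
    _ = 2 * Real.exp (-(Real.log 2 * x)) := by rw [Real.exp_add, Real.exp_log two_pos]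

variable [FiniteDimensional ℝ E]

theorem eventually_norm_exp_smul_le (D : E →L[ℝ] E) {r : ℝ} (hr : 0 < r) :
    ∀ᶠ t : ℝ in atTop, ∀ w ∈ contractingSpace D, ‖exp (t • D) w‖ ≤ r * ‖w‖ := by
  let b := Module.finBasis ℝ (contractingSpace D)
  obtain ⟨C, hC, hb⟩ := b.exists_opNorm_le (F := E)
  have hbasis : ∀ᶠ t : ℝ in atTop, ∀ i, ‖exp (t • D) (b i : E)‖ ≤ r / C :=
    eventually_all.2 fun i =>
      (mem_contractingSpace.1 (b i).2).norm.eventually_le_const (by simpa using div_pos hr hC)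
  filter_upwards [hbasis] with t ht w hw
  have hop := hb (u := (exp (t • D)).comp (contractingSpace D).subtypeL) (by positivity) ht
  rw [mul_div_cancel₀ _ hC.ne'] at hop
  exact ((exp (t • D)).comp (contractingSpace D).subtypeL).le_of_opNorm_le hop ⟨w, hw⟩

theorem exists_norm_exp_smul_le (D : E →L[ℝ] E) :
    ∃ c > 0, ∃ M > 0, ∀ w ∈ contractingSpace D, ∀ t : ℝ, 0 ≤ t →
      ‖exp (t • D) w‖ ≤ M * Real.exp (-(c * t)) * ‖w‖ := by
  have := FiniteDimensional.complete ℝ E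
  obtain ⟨T, hT, hT0⟩ := ((eventually_norm_exp_smul_le D one_half_pos).and
    (eventually_gt_atTop 0)).exists
  obtain ⟨B, hB⟩ := (isCompact_Icc (a := (0 : ℝ)) (b := T)).exists_bound_of_continuousOn
    (f := fun t : ℝ => exp (t • D)) (differentiable_exp_smul_const ℝ D).continuous.continuousOn
  refine ⟨Real.log 2 / T, by positivity, (|B| + 1) * 2, by positivity, fun w hw t ht => ?_⟩
  let n := ⌊t / T⌋₊
  have hn : n * T ≤ t := (le_div_iff₀ hT0).1 (Nat.floor_le (div_nonneg ht hT0.le))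
  have hn' : t < (n + 1) * T := (div_lt_iff₀ hT0).1 (Nat.lt_floor_add_one (t / T))
  have hs : t - n * T ∈ Set.Icc 0 T := ⟨by linarith, by linarith⟩
  calc ‖exp (t • D) w‖ = ‖exp ((t - n * T) • D) (exp ((n * T) • D) w)‖ := by
        rw [← exp_add_smul_apply, sub_add_cancel]
    _ ≤ ‖exp ((t - n * T) • D)‖ * ‖exp ((n * T) • D) w‖ := ContinuousLinearMap.le_opNorm _ _
    _ ≤ (|B| + 1) * ((1 / 2) ^ n * ‖w‖) := by
        gcongr
        · linarith [hB _ hs, le_abs_self B]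
        · exact norm_exp_nat_mul_smul_le one_half_pos.le hT n w hw
    _ ≤ (|B| + 1) * (2 * Real.exp (-(Real.log 2 * (t / T))) * ‖w‖) := by
        gcongr
        exact one_half_pow_floor_le _
    _ = (|B| + 1) * 2 * Real.exp (-(Real.log 2 / T * t)) * ‖w‖ := by ring_nf

theorem disjoint_contractingSpace_neg (D : E →L[ℝ] E) :
    Disjoint (contractingSpace D) (contractingSpace (-D)) := by
  have := FiniteDimensional.complete ℝ E
  refine Submodule.disjoint_def.2 fun w hw hw' => ?_
  obtain ⟨t, ht, ht'⟩ := ((eventually_norm_exp_smul_le D one_half_pos).and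
    (eventually_norm_exp_smul_le (-D) one_half_pos)).exists
  have hmem : exp (t • D) w ∈ contractingSpace (-D) := by
    simpa using exp_smul_mem_contractingSpace hw' (-t)
  have hinv : exp (t • -D) (exp (t • D) w) = w := by
    rw [smul_neg, ← neg_smul, ← exp_add_smul_apply]
    simp
  have hle := ht' _ hmem
  rw [hinv] at hle
  exact norm_eq_zero.1 (by linarith [ht w hw, norm_nonneg w])

theorem isSemisimple_baseChange_complex {V : Type*} [AddCommGroup V] [Module ℝ V]
    [FiniteDimensional ℝ V] {D : Module.End ℝ V} (hD : D.IsSemisimple) :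
    Module.End.IsSemisimple (LinearMap.baseChange ℂ D) := by
  refine Module.End.isSemisimple_of_squarefree_aeval_eq_zero
    (p := (minpoly ℝ D).map (algebraMap ℝ ℂ)) ?_ ?_
  · exact (PerfectField.separable_iff_squarefree.2 hD.minpoly_squarefree).map.squarefree
  · rw [Polynomial.aeval_map_algebraMap]
    change Polynomial.aeval (Module.End.baseChangeHom ℝ ℂ V D) (minpoly ℝ D) = 0
    rw [Polynomial.aeval_algHom_apply, minpoly.aeval, map_zero]

theorem exists_norm_complexCoeff_le {D : E →L[ℝ] E} (hD : IsEllipticMap (D : E →ₗ[ℝ] E))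
    (ξ : StrongDual ℝ E) (z : ℂ ⊗[ℝ] E) : ∃ C, ∀ t, ‖complexCoeff D ξ t z‖ ≤ C := by
  have := FiniteDimensional.complete ℝ E
  have hz : z ∈ ⨆ μ, Module.End.eigenspace (LinearMap.baseChange ℂ (D : E →ₗ[ℝ] E)) μ := by
    have htop := Module.End.iSup_maxGenEigenspace_eq_top (LinearMap.baseChange ℂ (D : E →ₗ[ℝ] E))
    simp only [(isSemisimple_baseChange_complex
      hD.1).isFinitelySemisimple.maxGenEigenspace_eq_eigenspace] at htop
    rw [htop]
    trivial
  induction hz using Submodule.iSup_induction' with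
  | mem μ z hz =>
    rcases eq_or_ne z 0 with rfl | hne
    · exact ⟨0, by simp⟩
    · have hre : μ.re = 0 := hD.2 μ (Module.End.hasEigenvalue_of_hasEigenvector ⟨hz, hne⟩)
      refine ⟨‖complexCoeff D ξ 0 z‖, fun t => ?_⟩
      simp [complexCoeff_of_mem_eigenspace ξ hz t, Complex.norm_exp, hre]
  | zero => exact ⟨0, by simp⟩
  | add x y _ _ hx hy =>
    obtain ⟨A, hA⟩ := hx
    obtain ⟨B, hB⟩ := hy
    exact ⟨A + B, fun t => by simpa only [map_add] using norm_add_le_of_le (hA t) (hB t)⟩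

theorem exists_norm_exp_smul_le_of_isEllipticMap {D : E →L[ℝ] E}
    (hD : IsEllipticMap (D : E →ₗ[ℝ] E)) : ∃ C, ∀ t : ℝ, ‖exp (t • D)‖ ≤ C := by
  have := FiniteDimensional.complete ℝ E
  refine banach_steinhaus fun v => ?_
  simp only [← (inclusionInDoubleDualLi ℝ (E := E)).norm_map]
  refine banach_steinhaus fun ξ => ?_
  obtain ⟨C, hC⟩ := exists_norm_complexCoeff_le hD ξ (1 ⊗ₜ v)
  exact ⟨C, fun t => by simpa [complexCoeff_tmul, inclusionInDoubleDualLi] using hC t⟩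

theorem exists_norm_exp_mul_exp_le {A N : E →L[ℝ] E} (hA : IsEllipticMap (A : E →ₗ[ℝ] E))
    (hN : IsNilpotent (N : E →ₗ[ℝ] E)) {c : ℝ} (hc : 0 < c) :
    ∃ C, ∀ t : ℝ, ‖exp (t • A) * exp (t • N)‖ ≤ C * Real.exp (c * |t|) := by
  have hN' : IsNilpotent N :=
    (IsNilpotent.map_iff (f := ContinuousLinearMap.toLinearMapRingHom (R₁ := ℝ) (M₁ := E))
      ContinuousLinearMap.coe_injective).1 hN
  obtain ⟨B, hB⟩ := exists_norm_exp_smul_le_of_isEllipticMap hA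
  obtain ⟨C, hC⟩ := exists_norm_exp_smul_le_of_isNilpotent hN' hc
  refine ⟨B * C, fun t => (norm_mul_le _ _).trans ?_⟩
  rw [mul_assoc]
  exact mul_le_mul (hB t) (hC t) (norm_nonneg _) ((norm_nonneg _).trans (hB t))

end LinearFlows

section ChartAtOne

open Filter

variable {E : Type*} [NormedAddCommGroup E]
  {G : Type*} [TopologicalSpace G] [ChartedSpace E G] [Group G]

variable (E G) in
/-- The preferred chart at the identity, in which all velocities and derivatives are computed. -/
abbrev oneChart : OpenPartialHomeomorph G E := chartAt E (1 : G)

theorem oneChart_symm_one : (oneChart E G).symm (oneChart E G 1) = 1 :=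
  (oneChart E G).left_inv (mem_chart_source E 1)

variable [NormedSpace ℝ E] {F : Type*} [NormedAddCommGroup F] [NormedSpace ℝ F]

/-- The derivative at the identity of a self-map of `G`, read in the preferred chart at the identity
on both sides. It is meaningful as soon as the map sends the identity into that chart. -/
def coordDeriv (Ψ : G → G) : E →L[ℝ] E :=
  fderiv ℝ (fun w => oneChart E G (Ψ ((oneChart E G).symm w))) (oneChart E G 1)

theorem coordDeriv_id : coordDeriv (id : G → G) = ContinuousLinearMap.id ℝ E :=
  ((hasFDerivAt_id _).congr_of_eventuallyEq
    ((oneChart E G).eventually_right_inverse (mem_chart_target E 1))).fderiv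

theorem mfderiv_one_eq_coordDeriv {Ψ : G → G} (hΨ : MDifferentiableAt 𝓘(ℝ, E) 𝓘(ℝ, E) Ψ 1)
    (h1 : Ψ 1 = 1) : mfderiv 𝓘(ℝ, E) 𝓘(ℝ, E) Ψ 1 = coordDeriv (E := E) Ψ := by
  rw [hΨ.mfderiv, modelWithCornersSelf_coe, Set.range_id, fderivWithin_univ]
  simp only [writtenInExtChartAt, h1]
  rfl

variable [LieGroup 𝓘(ℝ, E) ∞ G]

theorem contMDiffAt_oneChart {g : G} (hg : g ∈ (oneChart E G).source) :
    ContMDiffAt 𝓘(ℝ, E) 𝓘(ℝ, E) ∞ (oneChart E G) g :=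
  contMDiffOn_chart.contMDiffAt ((oneChart E G).open_source.mem_nhds hg)

theorem contMDiffAt_oneChart_symm :
    ContMDiffAt 𝓘(ℝ, E) 𝓘(ℝ, E) ∞ (oneChart E G).symm (oneChart E G 1) :=
  contMDiffOn_chart_symm.contMDiffAt ((oneChart E G).open_target.mem_nhds (mem_chart_target E 1))

theorem continuousAt_fderiv_oneChart {Ψ : G → F → G} {x : G} {w : F}
    (h : ContMDiffAt (𝓘(ℝ, E).prod 𝓘(ℝ, F)) 𝓘(ℝ, E) ∞ (Function.uncurry Ψ) (x, w))
    (hs : Ψ x w ∈ (oneChart E G).source) :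
    ContinuousAt (fun y => fderiv ℝ (fun w => oneChart E G (Ψ y w)) w) x := by
  have hchart : ContMDiffAt (𝓘(ℝ, E).prod 𝓘(ℝ, F)) 𝓘(ℝ, E) ∞
      (Function.uncurry fun y w => oneChart E G (Ψ y w)) (x, w) :=
    (contMDiffAt_oneChart hs).comp (x, w) h
  have hderiv := ContMDiffAt.mfderiv (m := 0) _ (fun _ => w) hchart contMDiffAt_const (by simp)
  simpa only [inTangentCoordinates_model_space, mfderiv_eq_fderiv] using hderiv.continuousAt

theorem contDiffAt_oneChart_comp {f : F → G} {w : F}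
    (hf : ContMDiffAt 𝓘(ℝ, F) 𝓘(ℝ, E) ∞ f w) (hs : f w ∈ (oneChart E G).source) :
    ContDiffAt ℝ ∞ (fun w => oneChart E G (f w)) w :=
  ((contMDiffAt_oneChart hs).comp w hf).contDiffAt

theorem contMDiffAt_comp_oneChart_symm {Ψ : G → G} (hΨ : ContMDiffAt 𝓘(ℝ, E) 𝓘(ℝ, E) ∞ Ψ 1) :
    ContMDiffAt 𝓘(ℝ, E) 𝓘(ℝ, E) ∞ (fun w => Ψ ((oneChart E G).symm w)) (oneChart E G 1) :=
  ContMDiffAt.comp _ (by rwa [oneChart_symm_one]) contMDiffAt_oneChart_symm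

theorem hasFDerivAt_coordDeriv {Ψ : G → G} (hΨ : ContMDiffAt 𝓘(ℝ, E) 𝓘(ℝ, E) ∞ Ψ 1)
    (hs : Ψ 1 ∈ (oneChart E G).source) :
    HasFDerivAt (fun w => oneChart E G (Ψ ((oneChart E G).symm w))) (coordDeriv Ψ)
      (oneChart E G 1) :=
  ((contDiffAt_oneChart_comp (contMDiffAt_comp_oneChart_symm hΨ)
    (by rwa [oneChart_symm_one])).differentiableAt (by simp)).hasFDerivAt

theorem hasFDerivAt_oneChart_comp {Ψ : G → G} (hΨ : ContMDiffAt 𝓘(ℝ, E) 𝓘(ℝ, E) ∞ Ψ 1)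
    (hs : Ψ 1 ∈ (oneChart E G).source) {f : F → G} {w : F} {L : F →L[ℝ] E}
    (hf : ContinuousAt f w) (h1 : f w = 1) (hL : HasFDerivAt (fun w => oneChart E G (f w)) L w) :
    HasFDerivAt (fun w => oneChart E G (Ψ (f w))) ((coordDeriv Ψ).comp L) w := by
  refine (HasFDerivAt.comp w (h1.symm ▸ hasFDerivAt_coordDeriv hΨ hs) hL).congr_of_eventuallyEq ?_
  filter_upwards [hf.eventually_mem ((oneChart E G).open_source.mem_nhds
    (h1.symm ▸ mem_chart_source E 1))] with v hv
  simp only [Function.comp_apply, (oneChart E G).left_inv hv]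

theorem hasDerivAt_oneChart_comp {Ψ : G → G} (hΨ : ContMDiffAt 𝓘(ℝ, E) 𝓘(ℝ, E) ∞ Ψ 1)
    (hs : Ψ 1 ∈ (oneChart E G).source) {c : ℝ → G} {t : ℝ} {v : E} (hc : ContinuousAt c t)
    (h1 : c t = 1) (hv : HasDerivAt (fun s => oneChart E G (c s)) v t) :
    HasDerivAt (fun s => oneChart E G (Ψ (c s))) (coordDeriv Ψ v) t := by
  simpa using (hasFDerivAt_oneChart_comp hΨ hs hc h1 hv.hasFDerivAt).hasDerivAt

theorem coordDeriv_comp {Ψ Φ : G → G} (hΨ : ContMDiffAt 𝓘(ℝ, E) 𝓘(ℝ, E) ∞ Ψ 1)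
    (hΦ : ContMDiffAt 𝓘(ℝ, E) 𝓘(ℝ, E) ∞ Φ 1) (hs : Ψ 1 ∈ (oneChart E G).source)
    (h1 : Φ 1 = 1) :
    coordDeriv (Ψ ∘ Φ) = (coordDeriv Ψ).comp (coordDeriv (E := E) Φ) :=
  (hasFDerivAt_oneChart_comp hΨ hs (contMDiffAt_comp_oneChart_symm hΦ).continuousAt
    (by rw [oneChart_symm_one, h1])
    (hasFDerivAt_coordDeriv hΦ (h1.symm ▸ mem_chart_source E 1))).fderiv

theorem hasFDerivAt_oneChart_mul :
    HasFDerivAt (fun p : E × E =>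
        oneChart E G ((oneChart E G).symm p.1 * (oneChart E G).symm p.2))
      (.fst ℝ E E + .snd ℝ E E) (oneChart E G 1, oneChart E G 1) := by
  set o := oneChart E G 1
  have hmul : ContMDiffAt 𝓘(ℝ, E × E) 𝓘(ℝ, E) ∞
      (fun p : E × E => (oneChart E G).symm p.1 * (oneChart E G).symm p.2) (o, o) :=
    (contMDiffAt_oneChart_symm.comp (o, o) contDiffAt_fst.contMDiffAt).mul
      (contMDiffAt_oneChart_symm.comp (o, o) contDiffAt_snd.contMDiffAt)
  have hdiff := ((contDiffAt_oneChart_comp hmul (by simp [o])).differentiableAt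
    (by simp)).hasFDerivAt
  have hid : HasFDerivAt (fun w => oneChart E G ((oneChart E G).symm w)) (.id ℝ E) o :=
    (hasFDerivAt_id o).congr_of_eventuallyEq
      ((oneChart E G).eventually_right_inverse (mem_chart_target E 1))
  have hcomp_inl : (fderiv ℝ _ (o, o)).comp (.inl ℝ E E) = .id ℝ E :=
    (HasFDerivAt.comp (f := fun w => (w, o)) o hdiff (hasFDerivAt_prodMk_left o o)).unique
      (by simpa [Function.comp_def, o, oneChart_symm_one] using hid)
  have hcomp_inr : (fderiv ℝ _ (o, o)).comp (.inr ℝ E E) = .id ℝ E :=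
    (HasFDerivAt.comp (f := fun w => (o, w)) o hdiff (hasFDerivAt_prodMk_right o o)).unique
      (by simpa [Function.comp_def, o, oneChart_symm_one] using hid)
  exact hdiff.congr_fderiv (ContinuousLinearMap.prod_ext
    (hcomp_inl.trans (by ext; simp)) (hcomp_inr.trans (by ext; simp)))

theorem hasDerivAt_oneChart_mul {c d : ℝ → G} {t : ℝ} {v w : E} (hc : ContinuousAt c t)
    (hd : ContinuousAt d t) (hc1 : c t = 1) (hd1 : d t = 1)
    (hv : HasDerivAt (fun s => oneChart E G (c s)) v t)
    (hw : HasDerivAt (fun s => oneChart E G (d s)) w t) :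
    HasDerivAt (fun s => oneChart E G (c s * d s)) (v + w) t := by
  have hsource : (oneChart E G).source ∈ 𝓝 (1 : G) := chart_source_mem_nhds E 1
  refine ((hasFDerivAt_oneChart_mul (G := G)).comp_hasDerivAt_of_eq t (hv.prodMk hw)
    (by rw [hc1, hd1])).congr_of_eventuallyEq ?_
  filter_upwards [hc.eventually_mem (hc1.symm ▸ hsource), hd.eventually_mem (hd1.symm ▸ hsource)]
    with s hs hs'
  simp only [Function.comp_apply, (oneChart E G).left_inv hs, (oneChart E G).left_inv hs']

theorem hasDerivAt_oneChart_of_mfderiv {c : ℝ → G} (hc : ContMDiff 𝓘(ℝ, ℝ) 𝓘(ℝ, E) ∞ c)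
    (h1 : c 0 = 1) :
    HasDerivAt (fun s => oneChart E G (c s)) (mfderiv 𝓘(ℝ, ℝ) 𝓘(ℝ, E) c 0 (1 : ℝ) : E) 0 := by
  have hderiv : mfderiv 𝓘(ℝ, ℝ) 𝓘(ℝ, E) c 0 = fderiv ℝ (fun s => oneChart E G (c s)) 0 := by
    rw [((hc 0).mdifferentiableAt (by simp)).mfderiv, modelWithCornersSelf_coe, Set.range_id,
      fderivWithin_univ]
    simp only [writtenInExtChartAt, h1]
    rfl
  rw [hderiv]
  exact ((contDiffAt_oneChart_comp (hc 0) (h1.symm ▸ mem_chart_source E 1)).differentiableAt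
    (by simp)).hasFDerivAt.hasDerivAt

end ChartAtOne

section Velocity

open Filter NormedSpace

variable {E : Type*} [NormedAddCommGroup E] [NormedSpace ℝ E]
  {G : Type*} [TopologicalSpace G] [ChartedSpace E G] [Group G]

namespace AutFlow

theorem map_zero_apply (φ : AutFlow E G) (g : G) : φ 0 g = g := by
  have h := φ.map_add 0 0 g
  rw [add_zero] at h
  exact ((φ 0).injective h).symm

theorem continuous_uncurry (φ : AutFlow E G) : Continuous fun p : ℝ × G => φ p.1 p.2 :=
  φ.smooth.continuous

theorem contMDiff_apply (φ : AutFlow E G) (t : ℝ) : ContMDiff 𝓘(ℝ, E) 𝓘(ℝ, E) ∞ (φ t) :=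
  φ.smooth.comp (contMDiff_const.prodMk contMDiff_id)

theorem contMDiff_orbit (φ : AutFlow E G) (g : G) :
    ContMDiff 𝓘(ℝ, ℝ) 𝓘(ℝ, E) ∞ (fun t => φ t g) :=
  φ.smooth.comp (contMDiff_id.prodMk contMDiff_const)

theorem continuous_orbit (φ : AutFlow E G) (g : G) : Continuous fun t => φ t g :=
  (φ.contMDiff_orbit g).continuous

theorem differential_eq_coordDeriv (φ : AutFlow E G) (t : ℝ) :
    φ.differential t = coordDeriv (φ t) :=
  mfderiv_one_eq_coordDeriv ((φ.contMDiff_apply t 1).mdifferentiableAt (by simp)) (map_one _)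

/-- The velocity at time zero of the orbit of `x`, left translated to the identity. -/
def velocity (φ : AutFlow E G) (x : G) : E :=
  deriv (fun t => oneChart E G (x⁻¹ * φ t x)) 0

theorem velocity_of_fixed (φ : AutFlow E G) {b : G} (hb : ∀ t, φ t b = b) :
    φ.velocity b = 0 := by
  simp [velocity, hb]

theorem velocity_one (φ : AutFlow E G) : φ.velocity 1 = 0 :=
  φ.velocity_of_fixed fun t => map_one (φ.toEquiv t)

end AutFlow

/-- The adjoint action of `G` on its tangent space at the identity. -/
def adjointAction (g : G) : E →L[ℝ] E := coordDeriv (fun y : G => g * y * g⁻¹)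

theorem adjointAction_one : adjointAction (1 : G) = ContinuousLinearMap.id ℝ E := by
  rw [← coordDeriv_id (G := G), adjointAction]
  congr 1
  funext y
  simp

variable [LieGroup 𝓘(ℝ, E) ∞ G]

theorem contMDiff_conj (g : G) : ContMDiff 𝓘(ℝ, E) 𝓘(ℝ, E) ∞ (fun y : G => g * y * g⁻¹) :=
  contMDiff_mul_left.mul contMDiff_const

theorem continuousAt_coordDeriv_const_mul :
    ContinuousAt (fun g : G => coordDeriv (E := E) (fun y : G => g * y)) 1 := by
  refine continuousAt_fderiv_oneChart (Ψ := fun g w => g * (oneChart E G).symm w) ?_ ?_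
  · exact contMDiffAt_fst.mul
      (contMDiffAt_oneChart_symm.comp ((1 : G), oneChart E G 1) contMDiffAt_snd)
  · simp

theorem continuousAt_adjointAction_one :
    ContinuousAt (fun g : G => adjointAction (E := E) g) 1 := by
  refine continuousAt_fderiv_oneChart (Ψ := fun g w => g * (oneChart E G).symm w * g⁻¹) ?_ ?_
  · exact (contMDiffAt_fst.mul (contMDiffAt_oneChart_symm.comp ((1 : G), oneChart E G 1)
      contMDiffAt_snd)).mul contMDiffAt_fst.inv
  · simp

theorem adjointAction_mul (g h : G) :
    adjointAction (E := E) (g * h) = (adjointAction g).comp (adjointAction h) := by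
  rw [adjointAction, adjointAction, adjointAction,
    ← coordDeriv_comp (contMDiff_conj g 1) (contMDiff_conj h 1) (by simp) (by simp)]
  congr 1
  funext y
  simp only [Function.comp_apply]
  group

theorem adjointAction_apply_inv_apply (g : G) (v : E) :
    adjointAction g (adjointAction g⁻¹ v) = v := by
  rw [← ContinuousLinearMap.comp_apply, ← adjointAction_mul, mul_inv_cancel, adjointAction_one,
    ContinuousLinearMap.id_apply]

namespace AutFlow

theorem differential_comp_adjointAction (φ : AutFlow E G) (t : ℝ) (g : G) :
    (φ.differential t).comp (adjointAction g) =
      (adjointAction (φ t g)).comp (φ.differential t) := by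
  rw [differential_eq_coordDeriv, adjointAction, adjointAction,
    ← coordDeriv_comp (φ.contMDiff_apply t 1) (contMDiff_conj g 1) (by simp) (by simp),
    ← coordDeriv_comp (contMDiff_conj (φ t g) 1) (φ.contMDiff_apply t 1) (by simp) (by simp)]
  congr 1
  funext y
  simp

theorem contMDiff_inv_mul_orbit (φ : AutFlow E G) (x : G) :
    ContMDiff 𝓘(ℝ, ℝ) 𝓘(ℝ, E) ∞ (fun t => x⁻¹ * φ t x) :=
  contMDiff_const.mul (φ.contMDiff_orbit x)

theorem hasDerivAt_velocity (φ : AutFlow E G) (x : G) :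
    HasDerivAt (fun t => oneChart E G (x⁻¹ * φ t x)) (φ.velocity x) 0 :=
  (hasDerivAt_oneChart_of_mfderiv (φ.contMDiff_inv_mul_orbit x)
    (by simp [map_zero_apply])).differentiableAt.hasDerivAt

theorem continuous_velocity (φ : AutFlow E G) : Continuous φ.velocity := by
  refine continuous_iff_continuousAt.2 fun x => ?_
  have h : ContinuousAt (fun x => fderiv ℝ (fun t => oneChart E G (x⁻¹ * φ t x)) 0) x := by
    refine continuousAt_fderiv_oneChart (Ψ := fun x t => x⁻¹ * φ t x) ?_ ?_
    · exact contMDiffAt_fst.inv.mul (φ.smooth.comp (contMDiff_snd.prodMk contMDiff_fst) (x, 0))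
    · simp [map_zero_apply]
  exact h.clm_apply continuousAt_const

theorem velocity_map (φ ψ : AutFlow E G) {s : ℝ} (h : ∀ t g, φ t (ψ s g) = ψ s (φ t g)) (x : G) :
    φ.velocity (ψ s x) = ψ.differential s (φ.velocity x) := by
  have hderiv := hasDerivAt_oneChart_comp (ψ.contMDiff_apply s 1) (by simp)
    (φ.contMDiff_inv_mul_orbit x).continuous.continuousAt (by simp [map_zero_apply])
    (φ.hasDerivAt_velocity x)
  rw [differential_eq_coordDeriv, ← hderiv.deriv, velocity]
  simp only [h, map_mul, map_inv]

theorem velocity_mul (φ : AutFlow E G) (x y : G) :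
    φ.velocity (x * y) = adjointAction y⁻¹ (φ.velocity x) + φ.velocity y := by
  have hcont := (φ.contMDiff_inv_mul_orbit x).continuous
  have hconj := hasDerivAt_oneChart_comp (contMDiff_conj y⁻¹ 1) (by simp) hcont.continuousAt
    (by simp [map_zero_apply]) (φ.hasDerivAt_velocity x)
  have hderiv := hasDerivAt_oneChart_mul
    ((contMDiff_conj (E := E) y⁻¹).continuous.comp hcont).continuousAt
    (φ.contMDiff_inv_mul_orbit y).continuous.continuousAt (by simp [map_zero_apply])
    (by simp [map_zero_apply]) hconj (φ.hasDerivAt_velocity y)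
  rw [adjointAction, ← hderiv.deriv, velocity]
  congr 1
  funext t
  simp only [Function.comp_apply, map_mul]
  group

theorem velocity_mul_of_fixed (φ : AutFlow E G) {b : G} (hb : ∀ t, φ t b = b) (x : G) :
    φ.velocity (b * x) = φ.velocity x := by
  rw [velocity_mul, φ.velocity_of_fixed hb, map_zero, zero_add]

theorem hasDerivAt_mul_orbit (φ : AutFlow E G) (g x : G) (t : ℝ)
    (hs : g * φ t x ∈ (oneChart E G).source) :
    HasDerivAt (fun s => oneChart E G (g * φ s x))
      (coordDeriv (fun y => (g * φ t x) * y) (φ.differential t (φ.velocity x))) t := by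
  have hderiv := hasDerivAt_oneChart_comp (Ψ := (fun y => (g * φ t x) * y) ∘ φ t)
    (contMDiff_mul_left.comp (φ.contMDiff_apply t) 1) (by simpa using hs)
    (φ.contMDiff_inv_mul_orbit x).continuous.continuousAt (by simp [map_zero_apply])
    (φ.hasDerivAt_velocity x)
  rw [coordDeriv_comp (contMDiff_mul_left 1) (φ.contMDiff_apply t 1) (by simpa using hs)
    (by simp), ← differential_eq_coordDeriv, ← sub_self t] at hderiv
  refine (hderiv.comp_sub_const t t).congr_of_eventuallyEq (.of_forall fun s => ?_)
  simp only [Function.comp_apply, map_mul, map_inv, ← φ.map_add, add_sub_cancel]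
  group

theorem eventually_orbit_eq_of_velocity_eq_zero (φ : AutFlow E G) {x : G}
    (hx : φ.velocity x = 0) (t : ℝ) : ∀ᶠ s in 𝓝 t, φ s x = φ t x := by
  set g := (φ t x)⁻¹ with hg
  have hnear : ∀ᶠ s in 𝓝 t, g * φ s x ∈ (oneChart E G).source :=
    (contMDiff_const.mul (φ.contMDiff_orbit x)).continuous.continuousAt.eventually_mem
      (by simpa [hg] using chart_source_mem_nhds E (1 : G))
  obtain ⟨ε, hε, hball⟩ := Metric.eventually_nhds_iff_ball.1 hnear
  have hderiv : ∀ s ∈ Metric.ball t ε, HasDerivAt (fun s => oneChart E G (g * φ s x)) 0 s := by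
    intro s hs
    simpa [hx] using φ.hasDerivAt_mul_orbit g x s (hball s hs)
  have ht := Metric.mem_ball_self (x := t) hε
  filter_upwards [Metric.ball_mem_nhds t hε] with s hs
  have heq := Metric.isOpen_ball.is_const_of_deriv_eq_zero (convex_ball t ε).isPreconnected
    (fun s hs => (hderiv s hs).differentiableAt.differentiableWithinAt)
    (fun s hs => (hderiv s hs).deriv) hs ht
  exact mul_left_cancel ((oneChart E G).injOn (hball s hs) (hball t ht) heq)

theorem fixed_of_velocity_eq_zero (φ : AutFlow E G) {x : G} (hx : φ.velocity x = 0) (t : ℝ) :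
    φ t x = x := by
  have hconst : IsLocallyConstant fun s => φ s x :=
    (IsLocallyConstant.iff_eventually_eq _).2 (φ.eventually_orbit_eq_of_velocity_eq_zero hx)
  rw [hconst.apply_eq_of_preconnectedSpace t 0, φ.map_zero_apply]

theorem JordanDecomposition.differential_eq {φ : AutFlow E G} (J : φ.JordanDecomposition) (t : ℝ) :
    φ.differential t =
      (exp (t • J.ellDer) * exp (t • J.nilDer)).comp (exp (t • J.hypDer)) := by
  have hφ : φ t = J.ell t ∘ J.nil t ∘ J.hyp t := by
    funext g
    simp only [Function.comp_apply, J.eq_comp, ← J.comm_hyp_nil, ← J.comm_hyp_ell]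
  rw [differential_eq_coordDeriv, hφ, coordDeriv_comp (J.ell.contMDiff_apply t 1)
      ((J.nil.contMDiff_apply t).comp (J.hyp.contMDiff_apply t) 1) (by simp) (by simp),
    coordDeriv_comp (J.nil.contMDiff_apply t 1) (J.hyp.contMDiff_apply t 1) (by simp) (by simp)]
  simp only [← differential_eq_coordDeriv, J.ell_der t, J.nil_der t, J.hyp_der t]
  rfl

end AutFlow

end Velocity

section DynamicalSubgroups

open Filter

variable {M F : Type*} [Group M] [FunLike F M M] [MonoidHomClass F M M]

/-- The common fixed points of a family of endomorphisms of a group. -/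
def fixedSubgroup (ψ : ℝ → F) : Subgroup M where
  carrier := {g | ∀ t, ψ t g = g}
  one_mem' t := map_one (ψ t)
  mul_mem' ha hb t := by rw [map_mul, ha t, hb t]
  inv_mem' ha t := by rw [map_inv, ha t]

theorem mem_fixedSubgroup {ψ : ℝ → F} {x : M} : x ∈ fixedSubgroup ψ ↔ ∀ t, ψ t x = x := Iff.rfl

theorem fixedSubgroup_comp_neg (ψ : ℝ → F) : fixedSubgroup (fun t => ψ (-t)) = fixedSubgroup ψ := by
  ext x
  exact ⟨fun h t => by simpa using h (-t), fun h t => h (-t)⟩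

theorem map_mem_fixedSubgroup {F' : Type*} [FunLike F' M M] {ψ : ℝ → F} {f : F'}
    (hcomm : ∀ t x, ψ t (f x) = f (ψ t x)) {x : M} (hx : x ∈ fixedSubgroup ψ) :
    f x ∈ fixedSubgroup ψ :=
  fun t => by rw [hcomm, hx t]

variable [TopologicalSpace M] [IsTopologicalGroup M]

/-- The points whose orbits converge to the identity in positive time. -/
def attractedSubgroup (ψ : ℝ → F) : Subgroup M where
  carrier := {x | Tendsto (fun t => ψ t x) atTop (𝓝 1)}
  one_mem' := by simpa using tendsto_const_nhds
  mul_mem' {a b} ha hb := by simpa using Tendsto.mul ha hb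
  inv_mem' {a} ha := by simpa using Tendsto.inv ha

/-- The points whose orbits converge to a common fixed point in positive time. -/
def convergentSubgroup (ψ : ℝ → F) : Subgroup M where
  carrier := {x | ∃ b ∈ fixedSubgroup ψ, Tendsto (fun t => ψ t x) atTop (𝓝 b)}
  one_mem' := ⟨1, one_mem _, by simpa using tendsto_const_nhds⟩
  mul_mem' := by
    rintro x y ⟨b, hb, hx⟩ ⟨c, hc, hy⟩
    exact ⟨b * c, mul_mem hb hc, by simpa using hx.mul hy⟩
  inv_mem' := by
    rintro x ⟨b, hb, hx⟩
    exact ⟨b⁻¹, inv_mem hb, by simpa using hx.inv⟩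

theorem mem_attractedSubgroup {ψ : ℝ → F} {x : M} :
    x ∈ attractedSubgroup ψ ↔ Tendsto (fun t => ψ t x) atTop (𝓝 1) := Iff.rfl

theorem attractedSubgroup_le_convergentSubgroup (ψ : ℝ → F) :
    attractedSubgroup ψ ≤ convergentSubgroup (M := M) ψ :=
  fun _ hx => ⟨1, one_mem _, hx⟩

theorem fixedSubgroup_le_convergentSubgroup (ψ : ℝ → F) :
    fixedSubgroup ψ ≤ convergentSubgroup (M := M) ψ :=
  fun x hx => ⟨x, hx, by simpa only [mem_fixedSubgroup.1 hx] using tendsto_const_nhds⟩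

theorem exists_mul_of_mem_convergentSubgroup {ψ : ℝ → F} {x : M} (hx : x ∈ convergentSubgroup ψ) :
    ∃ b ∈ fixedSubgroup ψ, ∃ a ∈ attractedSubgroup ψ, b * a = x := by
  obtain ⟨b, hb, hlim⟩ := hx
  refine ⟨b, hb, b⁻¹ * x, ?_, mul_inv_cancel_left b x⟩
  simpa [mem_attractedSubgroup, mem_fixedSubgroup.1 hb] using hlim.const_mul b⁻¹

theorem disjoint_fixedSubgroup_attractedSubgroup [T2Space M] (ψ : ℝ → F) :
    Disjoint (fixedSubgroup ψ) (attractedSubgroup (M := M) ψ) := by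
  refine Subgroup.disjoint_def.2 fun {x} hfix hattr => ?_
  simp only [mem_attractedSubgroup, mem_fixedSubgroup.1 hfix] at hattr
  exact tendsto_nhds_unique tendsto_const_nhds hattr

section Commuting

variable {F' : Type*} [FunLike F' M M] {ψ : ℝ → F} {f : F'}

theorem map_mem_attractedSubgroup [MonoidHomClass F' M M]
    (hcomm : ∀ t x, ψ t (f x) = f (ψ t x)) (hf : Continuous f) {x : M}
    (hx : x ∈ attractedSubgroup ψ) : f x ∈ attractedSubgroup ψ := by
  simpa only [mem_attractedSubgroup, hcomm, map_one, Function.comp_def] using (hf.tendsto 1).comp hx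

theorem map_mem_convergentSubgroup (hcomm : ∀ t x, ψ t (f x) = f (ψ t x)) (hf : Continuous f)
    {x : M} (hx : x ∈ convergentSubgroup ψ) : f x ∈ convergentSubgroup ψ := by
  obtain ⟨b, hb, hlim⟩ := hx
  exact ⟨f b, map_mem_fixedSubgroup hcomm hb, by
    simpa only [hcomm, Function.comp_def] using (hf.tendsto b).comp hlim⟩

end Commuting

end DynamicalSubgroups

section VelocityAsymptotics

open Filter NormedSpace

variable {E : Type*} [NormedAddCommGroup E] [NormedSpace ℝ E]
  {G : Type*} [TopologicalSpace G] [ChartedSpace E G] [Group G]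

namespace AutFlow

/-- The time reversal of a flow. -/
def rev (φ : AutFlow E G) : AutFlow E G where
  toEquiv t := φ (-t)
  map_add s t g := by rw [neg_add, φ.map_add]
  smooth := φ.smooth.comp ((contDiff_neg.contMDiff.comp contMDiff_fst).prodMk contMDiff_snd)

theorem rev_rev (φ : AutFlow E G) : φ.rev.rev = φ := by
  cases φ
  simp [rev]

theorem fixedSubgroup_rev (H : AutFlow E G) :
    fixedSubgroup H.rev.toEquiv = fixedSubgroup H.toEquiv :=
  fixedSubgroup_comp_neg H.toEquiv

theorem differential_rev (φ : AutFlow E G) (t : ℝ) :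
    φ.rev.differential t = φ.differential (-t) := rfl

theorem HasDerivation.rev {φ : AutFlow E G} {D : E →L[ℝ] E} (h : φ.HasDerivation D) :
    φ.rev.HasDerivation (-D) := fun t => by
  rw [differential_rev, h, smul_neg, neg_smul]

variable [LieGroup 𝓘(ℝ, E) ∞ G]

theorem velocity_rev (H : AutFlow E G) (x : G) : H.rev.velocity x = -H.velocity x := by
  have h := H.hasDerivAt_velocity x
  rw [← neg_zero] at h
  rw [← neg_one_smul ℝ]
  exact (h.scomp (0 : ℝ) (hasDerivAt_neg 0)).deriv

theorem velocity_apply_self {H : AutFlow E G} {D : E →L[ℝ] E} (hD : H.HasDerivation D) (t : ℝ)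
    (x : G) : H.velocity (H t x) = exp (t • D) (H.velocity x) := by
  rw [← hD t]
  exact H.velocity_map H (fun s g => by rw [← H.map_add, ← H.map_add, add_comm]) x

variable {H : AutFlow E G} {D : E →L[ℝ] E}

theorem mem_fixedSubgroup_of_velocity_mem [FiniteDimensional ℝ E] {x : G}
    (hpos : H.velocity x ∈ contractingSpace D) (hneg : H.velocity x ∈ contractingSpace (-D)) :
    x ∈ fixedSubgroup H.toEquiv :=
  H.fixed_of_velocity_eq_zero
    (Submodule.disjoint_def.1 (disjoint_contractingSpace_neg D) _ hpos hneg)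

variable [IsTopologicalGroup G]

theorem velocity_mem_contractingSpace (hD : H.HasDerivation D) {x : G}
    (hx : x ∈ convergentSubgroup H.toEquiv) : H.velocity x ∈ contractingSpace D := by
  obtain ⟨b, hb, hlim⟩ := hx
  simp only [mem_contractingSpace, ← velocity_apply_self hD]
  rw [← H.velocity_of_fixed hb]
  exact (H.continuous_velocity.tendsto b).comp hlim

theorem velocity_mem_contractingSpace_neg (hD : H.HasDerivation D) {x : G}
    (hx : x ∈ convergentSubgroup H.rev.toEquiv) : H.velocity x ∈ contractingSpace (-D) := by
  rw [← Submodule.neg_mem_iff, ← velocity_rev]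
  exact velocity_mem_contractingSpace hD.rev hx

theorem adjointAction_mem_contractingSpace (hD : H.HasDerivation D) {a : G}
    (ha : a ∈ attractedSubgroup H.toEquiv) {w : E} (hw : w ∈ contractingSpace D) :
    adjointAction a w ∈ contractingSpace D := by
  have hconj (t : ℝ) :
      exp (t • D) (adjointAction a w) = adjointAction (H t a) (exp (t • D) w) := by
    rw [← hD t]
    exact DFunLike.congr_fun (H.differential_comp_adjointAction t a) w
  simp only [mem_contractingSpace, hconj]
  have hlim : Tendsto (fun t => adjointAction (E := E) (H t a)) atTop (𝓝 (adjointAction (1 : G))) :=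
    continuousAt_adjointAction_one.tendsto.comp ha
  simpa [adjointAction_one, Function.comp_def] using
    (isBoundedBilinearMap_apply.continuous.tendsto (adjointAction (1 : G), (0 : E))).comp
      (hlim.prodMk_nhds (mem_contractingSpace.1 hw))

variable [FiniteDimensional ℝ E]

/-- In the presence of a product decomposition the velocity detects convergence: dividing by the
attracted factor leaves a point whose velocity is contracted in both time directions. -/
theorem convergentSubgroup_eq_preimage_velocity (hD : H.HasDerivation D)
    (hdec : (convergentSubgroup H.rev.toEquiv : Set G) * (attractedSubgroup H.toEquiv : Set G) =
      Set.univ) :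
    (convergentSubgroup H.toEquiv : Set G) = H.velocity ⁻¹' contractingSpace D := by
  ext x
  refine ⟨velocity_mem_contractingSpace hD, fun hx => ?_⟩
  obtain ⟨y, hy, a, ha, rfl⟩ := hdec.ge (Set.mem_univ x)
  have ha' := attractedSubgroup_le_convergentSubgroup _ ha
  have hvel : H.velocity y = adjointAction a (H.velocity (y * a) - H.velocity a) := by
    rw [velocity_mul, add_sub_cancel_right, adjointAction_apply_inv_apply]
  have hy' : H.velocity y ∈ contractingSpace D := hvel ▸ adjointAction_mem_contractingSpace hD ha
    (sub_mem hx (velocity_mem_contractingSpace hD ha'))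
  have hfix := mem_fixedSubgroup_of_velocity_mem hy' (velocity_mem_contractingSpace_neg hD hy)
  exact mul_mem (fixedSubgroup_le_convergentSubgroup _ hfix) ha'

theorem isClosed_convergentSubgroup (hD : H.HasDerivation D)
    (hdec : (convergentSubgroup H.rev.toEquiv : Set G) * (attractedSubgroup H.toEquiv : Set G) =
      Set.univ) :
    IsClosed (convergentSubgroup H.toEquiv : Set G) := by
  rw [convergentSubgroup_eq_preimage_velocity hD hdec]
  exact (Submodule.closed_of_finiteDimensional _).preimage H.continuous_velocity

end AutFlow

end VelocityAsymptotics

section ChartBarrier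

open Filter Set Metric

variable {X E : Type*} [TopologicalSpace X] [NormedAddCommGroup E]

theorem exists_forall_norm_chart_sub_lt_mem (e : OpenPartialHomeomorph X E) {x₀ : X}
    (hx₀ : x₀ ∈ e.source) {U : Set X} (hU : U ∈ 𝓝 x₀) :
    ∃ ε > 0, ∀ x ∈ e.source, ‖e x - e x₀‖ < ε → x ∈ U := by
  have hpre : e.symm ⁻¹' U ∈ 𝓝 (e x₀) := by
    refine (e.continuousAt_symm (e.map_source hx₀)).preimage_mem_nhds ?_
    rwa [e.left_inv hx₀]
  obtain ⟨ε, hε, hball⟩ := Metric.mem_nhds_iff.1 hpre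
  refine ⟨ε, hε, fun x hx hlt => ?_⟩
  have hxU := hball (mem_ball_iff_norm.2 hlt)
  rwa [mem_preimage, e.left_inv hx] at hxU

section Closed

variable [T2Space X] [ProperSpace E] {e : OpenPartialHomeomorph X E} {w : E} {R : ℝ}

theorem isClosed_source_inter_preimage_closedBall (hR : closedBall w R ⊆ e.target) :
    IsClosed (e.source ∩ e ⁻¹' closedBall w R) := by
  rw [← e.symm_image_eq_source_inter_preimage hR]
  exact ((isCompact_closedBall w R).image_of_continuousOn (e.continuousOn_symm.mono hR)).isClosed

theorem isClosed_setOf_norm_chart_sub_le (hR : closedBall w R ⊆ e.target) {c : ℝ → X}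
    (hc : Continuous c) {b : ℝ → ℝ} (hb : Continuous b) {s : Set ℝ} (hs : IsClosed s)
    (hbR : ∀ t ∈ s, b t ≤ R) :
    IsClosed ({t | c t ∈ e.source ∧ ‖e (c t) - w‖ ≤ b t} ∩ s) := by
  have hK := ((isClosed_source_inter_preimage_closedBall hR).preimage hc).inter hs
  have hchart : ContinuousOn (fun t => e (c t)) (c ⁻¹' (e.source ∩ e ⁻¹' closedBall w R) ∩ s) :=
    e.continuousOn.comp hc.continuousOn fun t ht => ht.1.1
  have hdist : ContinuousOn (fun t => ‖e (c t) - w‖)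
      (c ⁻¹' (e.source ∩ e ⁻¹' closedBall w R) ∩ s) := (hchart.sub continuousOn_const).norm
  convert hK.isClosed_le hdist hb.continuousOn using 1
  ext t
  simp only [mem_inter_iff, mem_ofPred_eq, mem_preimage, mem_closedBall_iff_norm]
  exact ⟨fun ⟨⟨hsrc, hle⟩, ht⟩ => ⟨⟨⟨hsrc, hle.trans (hbR t ht)⟩, ht⟩, hle⟩,
    fun ⟨⟨⟨hsrc, _⟩, ht⟩, hle⟩ => ⟨⟨hsrc, hle⟩, ht⟩⟩

end Closed

variable [NormedSpace ℝ E]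

theorem eventually_norm_le_of_norm_deriv_le {f : ℝ → E} {b b' : ℝ → ℝ} {t : ℝ}
    (hb : ∀ s, HasDerivAt b (b' s) s) (ht : ‖f t‖ ≤ b t)
    (hf : ∀ᶠ s in 𝓝[≥] t, ∃ v, HasDerivAt f v s ∧ ‖v‖ ≤ b' s) :
    ∀ᶠ s in 𝓝[>] t, ‖f s‖ ≤ b s := by
  obtain ⟨u, hu, hsub⟩ := mem_nhdsGE_iff_exists_Icc_subset.1 hf
  choose! f' hf' hle using hsub
  filter_upwards [Icc_mem_nhdsGT hu] with s hs
  exact image_norm_le_of_norm_deriv_right_le_deriv_boundary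
    (fun r hr => (hf' hr).continuousAt.continuousWithinAt)
    (fun r hr => (hf' (Ico_subset_Icc_self hr)).hasDerivWithinAt) ht hb
    (fun r hr => hle (Ico_subset_Icc_self hr)) hs

/-- A bootstrap: the derivative needs to be controlled only while the curve stays in the chart and
`R`-close to `w`, which the barrier `b < R` guarantees a posteriori. -/
theorem norm_chart_sub_le_of_norm_deriv_le [T2Space X] [ProperSpace E]
    {e : OpenPartialHomeomorph X E} {w : E} {R : ℝ} (hR : closedBall w R ⊆ e.target)
    {c : ℝ → X} (hc : Continuous c) {b b' : ℝ → ℝ} (hb : ∀ t, HasDerivAt b (b' t) t) {T : ℝ}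
    (h0 : c 0 ∈ e.source) (hb0 : ‖e (c 0) - w‖ ≤ b 0) (hbR : ∀ t ∈ Icc 0 T, b t < R)
    (hder : ∀ t ∈ Icc 0 T, c t ∈ e.source → ‖e (c t) - w‖ < R →
      ∃ v, HasDerivAt (fun s => e (c s)) v t ∧ ‖v‖ ≤ b' t) :
    ∀ t ∈ Icc 0 T, c t ∈ e.source ∧ ‖e (c t) - w‖ ≤ b t := by
  have hbc : Continuous b := continuous_iff_continuousAt.2 fun t => (hb t).continuousAt
  refine (isClosed_setOf_norm_chart_sub_le hR hc hbc isClosed_Icc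
    fun t ht => (hbR t ht).le).Icc_subset_of_forall_mem_nhdsWithin ⟨h0, hb0⟩ ?_
  rintro t ⟨⟨hsrc, hle⟩, ht0, htT⟩
  have hcont : ContinuousAt (fun s => e (c s)) t :=
    ContinuousAt.comp (f := c) (e.continuousAt hsrc) hc.continuousAt
  have hsrc' : ∀ᶠ s in 𝓝 t, c s ∈ e.source :=
    hc.continuousAt.eventually_mem (e.open_source.mem_nhds hsrc)
  have hnear : ∀ᶠ s in 𝓝 t, ‖e (c s) - w‖ < R :=
    (hcont.sub continuousAt_const).norm.eventually_lt_const
      (hle.trans_lt (hbR t ⟨ht0, htT.le⟩))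
  refine (hsrc'.filter_mono nhdsWithin_le_nhds).and
    (eventually_norm_le_of_norm_deriv_le hb hle ?_)
  filter_upwards [Icc_mem_nhdsGE htT, nhdsWithin_le_nhds hsrc', nhdsWithin_le_nhds hnear]
    with s hs hs' hsR
  obtain ⟨v, hv, hvb⟩ := hder s ⟨ht0.trans hs.1, hs.2⟩ hs' hsR
  exact ⟨v, hv.sub_const w, hvb⟩

end ChartBarrier

section SmallVelocity

open Filter

variable {E : Type*} [NormedAddCommGroup E] [NormedSpace ℝ E]
  {G : Type*} [TopologicalSpace G] [ChartedSpace E G] [Group G] [LieGroup 𝓘(ℝ, E) ∞ G]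

theorem exists_norm_coordDeriv_const_mul_le (E G : Type*) [NormedAddCommGroup E]
    [NormedSpace ℝ E] [TopologicalSpace G] [ChartedSpace E G] [Group G] [LieGroup 𝓘(ℝ, E) ∞ G] :
    ∃ R > 0, ∃ C > 0, Metric.closedBall (oneChart E G 1) R ⊆ (oneChart E G).target ∧
      ∀ g ∈ (oneChart E G).source, ‖oneChart E G g - oneChart E G 1‖ < R →
        ‖coordDeriv (E := E) (fun y : G => g * y)‖ ≤ C := by
  obtain ⟨R₁, hR₁, hball⟩ := Metric.nhds_basis_closedBall.mem_iff.1
    (chart_target_mem_nhds E (1 : G))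
  have hlt : ∀ᶠ g in 𝓝 (1 : G), ‖coordDeriv (E := E) (fun y : G => g * y)‖ <
      ‖coordDeriv (E := E) (fun y : G => 1 * y)‖ + 1 :=
    continuousAt_coordDeriv_const_mul.norm.eventually_lt_const (lt_add_one _)
  obtain ⟨R₂, hR₂, hC⟩ :=
    exists_forall_norm_chart_sub_lt_mem (oneChart E G) (mem_chart_source E 1) hlt
  exact ⟨min R₁ R₂, lt_min hR₁ hR₂, _, by positivity,
    (Metric.closedBall_subset_closedBall (min_le_left _ _)).trans hball,
    fun g hg hgR => (hC g hg (hgR.trans_le (min_le_right _ _))).le⟩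

theorem hasDerivAt_oneChart_oneParameter {γ : ℝ → G} (hγ : ∀ s t, γ (s + t) = γ s * γ t)
    (hcont : Continuous γ) {v : E} (hv : HasDerivAt (fun s => oneChart E G (γ s)) v 0) {t : ℝ}
    (hs : γ t ∈ (oneChart E G).source) :
    HasDerivAt (fun s => oneChart E G (γ s)) (coordDeriv (fun y => γ t * y) v) t := by
  have hderiv := hasDerivAt_oneChart_comp (contMDiff_mul_left (a := γ t) 1) (by simpa using hs)
    hcont.continuousAt (by simpa using hγ 0 0) hv
  rw [← sub_self t] at hderiv
  refine (hderiv.comp_sub_const t t).congr_of_eventuallyEq (.of_forall fun s => ?_)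
  simp only [← hγ, add_sub_cancel]

variable [FiniteDimensional ℝ E] [T2Space G]

/-- Here `u` is the left logarithmic derivative of the curve `c`, and `a` majorizes the primitive of
`‖u‖`: a curve is displaced little if the total size of its logarithmic derivative is small. -/
theorem exists_nhds_forall_curve_mem {U : Set G} (hU : U ∈ 𝓝 (1 : G)) :
    ∃ V ∈ 𝓝 (1 : G), ∃ δ > 0, ∀ (c : ℝ → G) (u : ℝ → E) (a a' : ℝ → ℝ) (T : ℝ), 0 ≤ T →
      Continuous c → (∀ t, HasDerivAt a (a' t) t) → 0 ≤ a 0 → (∀ t ∈ Set.Icc 0 T, a t < δ) →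
      (∀ t ∈ Set.Icc 0 T, c t ∈ (oneChart E G).source →
        HasDerivAt (fun s => oneChart E G (c s)) (coordDeriv (fun y => c t * y) (u t)) t) →
      (∀ t ∈ Set.Icc 0 T, ‖u t‖ ≤ a' t) → c 0 ∈ V → c T ∈ U := by
  have : ProperSpace E := FiniteDimensional.proper ℝ E
  obtain ⟨ε, hε, hεU⟩ :=
    exists_forall_norm_chart_sub_lt_mem (oneChart E G) (mem_chart_source E 1) hU
  obtain ⟨R, hR, C, hC, hball, hbound⟩ := exists_norm_coordDeriv_const_mul_le E G
  have hη : 0 < min ε R / 2 := by positivity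
  have hnear : ∀ᶠ g in 𝓝 (1 : G), g ∈ (oneChart E G).source ∧
      ‖oneChart E G g - oneChart E G 1‖ < min ε R / 2 :=
    Eventually.and (chart_source_mem_nhds E (1 : G))
      ((((oneChart E G).continuousAt (mem_chart_source E 1)).sub
        continuousAt_const).norm.eventually_lt_const (by simpa using hη))
  refine ⟨_, hnear, min ε R / 2 / C, by positivity,
    fun c u a a' T hT hc ha ha0 haδ hder hu ⟨hc0, hc0'⟩ => ?_⟩
  have hbarrier : ∀ t ∈ Set.Icc 0 T, min ε R / 2 + C * a t < min ε R := fun t ht => by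
    have := (lt_div_iff₀' hC).1 (haδ t ht)
    linarith
  obtain ⟨hsrc, hle⟩ := norm_chart_sub_le_of_norm_deriv_le hball hc
    (fun t => ((ha t).const_mul C).const_add (min ε R / 2)) hc0
    (hc0'.le.trans (le_add_of_nonneg_right (by positivity)))
    (fun t ht => (hbarrier t ht).trans_le (min_le_right _ _))
    (fun t ht hs hsR => ⟨_, hder t ht hs, ((coordDeriv _).le_of_opNorm_le (hbound _ hs hsR) _).trans
      (mul_le_mul_of_nonneg_left (hu t ht) hC.le)⟩) T ⟨hT, le_rfl⟩
  exact hεU _ hsrc (hle.trans_lt ((hbarrier T ⟨hT, le_rfl⟩).trans_le (min_le_left _ _)))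

theorem exists_forall_oneParameter_mem {U : Set G} (hU : U ∈ 𝓝 (1 : G)) :
    ∃ r > 0, ∀ γ : ℝ → G, (∀ s t, γ (s + t) = γ s * γ t) → ∀ v : E, Continuous γ →
      HasDerivAt (fun s => oneChart E G (γ s)) v 0 → ‖v‖ < r → γ 1 ∈ U := by
  obtain ⟨V, hV, δ, hδ, hcurve⟩ := exists_nhds_forall_curve_mem (E := E) hU
  refine ⟨δ, hδ, fun γ hγ v hcont hv hlt => ?_⟩
  have hγ0 : γ 0 = 1 := by simpa using hγ 0 0
  refine hcurve γ (fun _ => v) (fun t => ‖v‖ * t) (fun _ => ‖v‖) 1 zero_le_one hcont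
    (fun t => by simpa using (hasDerivAt_id t).const_mul ‖v‖) (by simp)
    (fun t ht => (mul_le_of_le_one_right (norm_nonneg v) ht.2).trans_lt hlt)
    (fun t _ hs => hasDerivAt_oneChart_oneParameter hγ hcont hv hs) (fun _ _ => le_rfl) ?_
  exact hγ0 ▸ mem_of_mem_nhds hV

namespace AutFlow

theorem exists_forall_norm_velocity_lt_mem [IsTopologicalGroup G] {H : AutFlow E G} {D : E →L[ℝ] E}
    (hD : H.HasDerivation D) {U : Set G} (hU : U ∈ 𝓝 (1 : G)) :
    ∃ r > 0, ∀ x ∈ attractedSubgroup H.toEquiv, ‖H.velocity x‖ < r → x ∈ U := by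
  obtain ⟨V, hV, δ, hδ, hcurve⟩ := exists_nhds_forall_curve_mem (E := E) hU
  obtain ⟨k, hk, M, hM, hdecay⟩ := exists_norm_exp_smul_le D
  refine ⟨δ / (M / k), by positivity, fun x hx hlt => ?_⟩
  have hvel := velocity_mem_contractingSpace hD (attractedSubgroup_le_convergentSubgroup _ hx)
  obtain ⟨T, hTV, hT⟩ := ((hx.eventually_mem hV).and (eventually_ge_atTop 0)).exists
  -- the orbit is followed backwards in time, from `H T x` near `1` to `x`
  have hcont : Continuous fun s => H (T - s) x :=
    (H.continuous_orbit x).comp (continuous_const.sub continuous_id)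
  have hprim (s : ℝ) : HasDerivAt (fun s => M / k * ‖H.velocity x‖ * Real.exp (-(k * (T - s))))
      (M * Real.exp (-(k * (T - s))) * ‖H.velocity x‖) s := by
    have hexp : HasDerivAt (fun s : ℝ => -(k * (T - s))) k s := by
      simpa using (((hasDerivAt_id s).const_sub T).const_mul k).fun_neg
    refine (hexp.exp.const_mul _).congr_deriv ?_
    field_simp
  have hsmall : ∀ s ∈ Set.Icc 0 T, M / k * ‖H.velocity x‖ * Real.exp (-(k * (T - s))) < δ := by
    intro s hs
    have hexp : Real.exp (-(k * (T - s))) ≤ 1 :=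
      Real.exp_le_one_iff.2 (neg_nonpos.2 (mul_nonneg hk.le (sub_nonneg.2 hs.2)))
    exact (mul_le_of_le_one_right (by positivity) hexp).trans_lt
      ((lt_div_iff₀' (by positivity)).1 hlt)
  have hend := hcurve _ (fun s => -(H.differential (T - s) (H.velocity x))) _ _ T hT hcont hprim
    (by positivity) hsmall (fun s _ hs => ?_) (fun s hs => ?_) (by simpa using hTV)
  · simpa [map_zero_apply] using hend
  · rw [_root_.map_neg]
    have := H.hasDerivAt_mul_orbit 1 x (T - s) (by simpa using hs)
    simp only [one_mul] at this
    exact this.comp_const_sub T s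
  · rw [norm_neg, hD]
    exact hdecay _ hvel _ (sub_nonneg.2 hs.2)

end AutFlow

end SmallVelocity

section OpenFactorization

open Filter Set

variable {G : Type*} [Group G]

theorem coe_closure_subset_iUnion_pow (C : Set G) :
    (Subgroup.closure C : Set G) ⊆ ⋃ n : ℕ, (C ∪ C⁻¹) ^ n := by
  intro x hx
  induction hx using Subgroup.closure_induction with
  | mem x hx => exact mem_iUnion.2 ⟨1, by simp [hx]⟩
  | one => exact mem_iUnion.2 ⟨0, by simp⟩
  | mul x y _ _ hx hy =>
    obtain ⟨m, hm⟩ := mem_iUnion.1 hx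
    obtain ⟨n, hn⟩ := mem_iUnion.1 hy
    exact mem_iUnion.2 ⟨m + n, pow_add (C ∪ C⁻¹) m n ▸ mul_mem_mul hm hn⟩
  | inv x _ hx =>
    obtain ⟨n, hn⟩ := mem_iUnion.1 hx
    have hsymm : (C ∪ C⁻¹)⁻¹ = C ∪ C⁻¹ := by rw [union_inv, inv_inv, union_comm]
    exact mem_iUnion.2 ⟨n, by rwa [← hsymm, inv_pow, Set.inv_mem_inv]⟩

variable [TopologicalSpace G] [IsTopologicalGroup G]

theorem sigmaCompactSpace_of_connectedSpace [ConnectedSpace G] [LocallyCompactSpace G] :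
    SigmaCompactSpace G := by
  obtain ⟨C, hC, hC1⟩ := exists_compact_mem_nhds (1 : G)
  have hopen : IsOpen (Subgroup.closure C : Set G) :=
    Subgroup.isOpen_of_mem_nhds _ (mem_of_superset hC1 Subgroup.subset_closure)
  have huniv : (Subgroup.closure C : Set G) = univ :=
    IsClopen.eq_univ ⟨Subgroup.isClosed_of_isOpen _ hopen, hopen⟩ ⟨1, one_mem _⟩
  have hpow (n : ℕ) : IsCompact ((C ∪ C⁻¹) ^ n) := by
    induction n with
    | zero => rw [pow_zero]; exact isCompact_singleton
    | succ n ih => rw [pow_succ]; exact ih.mul (hC.union hC.inv)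
  rw [← isSigmaCompact_univ_iff,
    ← univ_subset_iff.1 (huniv ▸ coe_closure_subset_iUnion_pow C)]
  exact isSigmaCompact_iUnion_of_isCompact _ hpow

theorem nhdsWithin_one_mul_nhdsWithin_one_le (Q : Subgroup G) :
    𝓝[(Q : Set G)] 1 * 𝓝[(Q : Set G)] 1 ≤ 𝓝[(Q : Set G)] 1 := by
  rw [nhdsWithin, le_inf_iff]
  refine ⟨?_, ?_⟩
  · calc _ ≤ 𝓝 (1 : G) * 𝓝 1 := mul_le_mul' inf_le_left inf_le_left
      _ = 𝓝 1 := by rw [← nhds_mul, one_mul]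
  · refine le_principal_iff.2 (mem_of_superset (mul_mem_mul self_mem_nhdsWithin
      self_mem_nhdsWithin) (mul_subset_iff.2 fun x hx y hy => Q.mul_mem hx hy))

/-- By the open mapping theorem for the action of `A` on the homogeneous space `G ⧸ B`. -/
theorem nhds_one_le_nhdsWithin_mul_nhdsWithin [LocallyCompactSpace G] [SigmaCompactSpace G]
    {A B : Subgroup G} (hA : IsClosed (A : Set G)) (hB : IsClosed (B : Set G))
    (hAB : (A : Set G) * (B : Set G) = univ) :
    𝓝 (1 : G) ≤ 𝓝[(A : Set G)] 1 * 𝓝[(B : Set G)] 1 := by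
  have : SigmaCompactSpace A := hA.isClosedEmbedding_subtypeVal.sigmaCompactSpace
  have : ContinuousSMul A (G ⧸ B) := Subgroup.continuousSMul
  have : MulAction.IsPretransitive A (G ⧸ B) := by
    refine (MulAction.isPretransitive_iff_base ((1 : G) : G ⧸ B)).2 <|
      QuotientGroup.mk_surjective.forall.2 fun x => ?_
    obtain ⟨a, ha, b, hb, rfl⟩ := hAB.ge (mem_univ x)
    exact ⟨⟨a, ha⟩, QuotientGroup.eq.2 (by simpa using hb)⟩
  intro s hs
  obtain ⟨S, hS, T, hT, hST⟩ := mem_mul.1 hs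
  obtain ⟨T', hT', hTB⟩ := mem_nhdsWithin_iff_exists_mem_nhds_inter.1 hT
  obtain ⟨V, hV, hVT⟩ := exists_nhds_split_inv hT'
  have hVinv : V⁻¹ ∈ 𝓝 (1 : G) := inv_mem_nhds_one G hV
  have hSV : ((↑) : A → G) ⁻¹' (S ∩ V⁻¹) ∈ 𝓝 (1 : A) :=
    preimage_coe_mem_nhds_subtype.2 (inter_mem hS (mem_nhdsWithin_of_mem_nhds hVinv))
  have horbit := smul_singleton_mem_nhds_of_sigmaCompact hSV ((1 : G) : G ⧸ B)
  filter_upwards [QuotientGroup.continuous_mk.continuousAt.preimage_mem_nhds horbit, hVinv]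
    with x hx hxV
  obtain ⟨a, ⟨haS, haV⟩, _, rfl, hax⟩ := hx
  have hb : (a : G)⁻¹ * x ∈ B := by simpa using QuotientGroup.eq.1 hax
  refine hST ⟨a, haS, (a : G)⁻¹ * x, hTB ⟨?_, hb⟩, mul_inv_cancel_left _ x⟩
  simpa using hVT _ haV _ hxV

end OpenFactorization

section Contraction

open Filter NormedSpace

variable {E : Type*} [NormedAddCommGroup E] [NormedSpace ℝ E] [FiniteDimensional ℝ E]

theorem tendsto_norm_mul_exp_smul_comp_subtypeL (D : E →L[ℝ] E) {B : ℝ → E →L[ℝ] E}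
    (hB : ∀ c > 0, ∃ C, ∀ t, ‖B t‖ ≤ C * Real.exp (c * |t|)) :
    Tendsto (fun t => ‖(B t * exp (t • D)).comp (contractingSpace D).subtypeL‖) atTop (𝓝 0) := by
  obtain ⟨k, hk, M, hM, hdecay⟩ := exists_norm_exp_smul_le D
  obtain ⟨C, hC⟩ := hB (k / 2) (by positivity)
  have hexp : Tendsto (fun t : ℝ => Real.exp (-(k / 2) * t)) atTop (𝓝 0) :=
    Real.tendsto_exp_atBot.comp (tendsto_id.const_mul_atTop_of_neg (by linarith))
  have hlim : Tendsto (fun t : ℝ => C * M * Real.exp (-(k / 2) * t)) atTop (𝓝 0) := by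
    simpa only [mul_zero] using hexp.const_mul (C * M)
  refine squeeze_zero' (.of_forall fun t => ContinuousLinearMap.opNorm_nonneg _) ?_ hlim
  filter_upwards [eventually_ge_atTop 0] with t ht
  have hBt : ‖B t‖ ≤ C * Real.exp (k / 2 * t) := by simpa only [abs_of_nonneg ht] using hC t
  have hC0 : 0 ≤ C :=
    (mul_nonneg_iff_of_pos_right (Real.exp_pos _)).1 ((norm_nonneg (B t)).trans hBt)
  refine ContinuousLinearMap.opNorm_le_bound _ (by positivity) fun w => ?_
  calc ‖B t (exp (t • D) w)‖ ≤ ‖B t‖ * ‖exp (t • D) (w : E)‖ := (B t).le_opNorm _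
    _ ≤ (C * Real.exp (k / 2 * t)) * (M * Real.exp (-(k * t)) * ‖w‖) := by
        gcongr
        exact hdecay w w.2 t ht
    _ = C * M * Real.exp (-(k / 2) * t) * ‖w‖ := by
        rw [show -(k / 2) * t = k / 2 * t + -(k * t) by ring, Real.exp_add]
        ring

variable {G : Type*} [TopologicalSpace G] [ChartedSpace E G] [Group G] [LieGroup 𝓘(ℝ, E) ∞ G]

namespace AutFlow

namespace JordanDecomposition

variable {φ : AutFlow E G} (J : φ.JordanDecomposition)

theorem tendsto_norm_differential_comp_subtypeL :
    Tendsto (fun t => ‖(φ.differential t).comp (contractingSpace J.hypDer).subtypeL‖)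
      atTop (𝓝 0) := by
  simp only [J.differential_eq]
  exact tendsto_norm_mul_exp_smul_comp_subtypeL J.hypDer
    fun c hc => exists_norm_exp_mul_exp_le J.ell_elliptic J.nil_nilpotent hc

theorem tendsto_norm_differential_rev_comp_subtypeL :
    Tendsto (fun t => ‖(φ.rev.differential t).comp (contractingSpace (-J.hypDer)).subtypeL‖)
      atTop (𝓝 0) := by
  simp only [differential_rev, J.differential_eq, ← smul_neg, neg_smul]
  refine tendsto_norm_mul_exp_smul_comp_subtypeL (-J.hypDer) fun c hc => ?_
  obtain ⟨C, hC⟩ := exists_norm_exp_mul_exp_le J.ell_elliptic J.nil_nilpotent hc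
  exact ⟨C, fun t => by simpa using hC (-t)⟩

end JordanDecomposition

variable [T2Space G] [IsTopologicalGroup G] {φ H : AutFlow E G} {D : E →L[ℝ] E}

theorem contractsToOne_attractedSubgroup (hD : H.HasDerivation D)
    (hcomm : ∀ s t g, H s (φ t g) = φ t (H s g))
    (hφ : Tendsto (fun t => ‖(φ.differential t).comp (contractingSpace D).subtypeL‖) atTop (𝓝 0)) :
    ContractsToOne (fun t => φ t) (attractedSubgroup H.toEquiv : Set G) := by
  intro p _
  have hV : ∀ᶠ x in 𝓝 (1 : G), ‖H.velocity x‖ < ‖H.velocity p‖ + 1 := by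
    refine H.continuous_velocity.norm.continuousAt.eventually_lt_const ?_
    simp only [H.velocity_one, norm_zero]
    positivity
  refine ⟨_, hV, lt_add_one ‖H.velocity p‖, fun U hU => ?_⟩
  obtain ⟨r, hr, hsmall⟩ := exists_forall_norm_velocity_lt_mem hD hU
  have hnorm : ∀ᶠ t in atTop, ‖(φ.differential t).comp (contractingSpace D).subtypeL‖ <
      r / (‖H.velocity p‖ + 1) := hφ.eventually_lt_const (by positivity)
  refine eventually_prod_principal_iff.2 (hnorm.mono fun t ht x ⟨hx, hxV⟩ => ?_)
  have hvel : H.velocity x ∈ contractingSpace D :=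
    velocity_mem_contractingSpace hD (attractedSubgroup_le_convergentSubgroup _ hx)
  refine hsmall (φ t x) (map_mem_attractedSubgroup (f := φ.toEquiv t) (fun s g => hcomm s t g)
    (φ.contMDiff_apply t).continuous hx) ?_
  calc ‖H.velocity (φ t x)‖ = ‖φ.differential t (H.velocity x)‖ := by
        rw [H.velocity_map φ fun s g => hcomm s t g]
    _ ≤ ‖(φ.differential t).comp (contractingSpace D).subtypeL‖ * ‖H.velocity x‖ :=
        ((φ.differential t).comp (contractingSpace D).subtypeL).le_opNorm ⟨H.velocity x, hvel⟩
    _ ≤ ‖(φ.differential t).comp (contractingSpace D).subtypeL‖ * (‖H.velocity p‖ + 1) := by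
        gcongr
        exact hxV.le
    _ < r := (lt_div_iff₀ (by positivity)).1 ht

theorem connectedSubgroup_le_attractedSubgroup (hD : H.HasDerivation D) {W : Submodule ℝ E}
    (hW : W ≤ contractingSpace D) : connectedSubgroup W ≤ attractedSubgroup H.toEquiv := by
  refine (Subgroup.closure_le _).2 ?_
  rintro _ ⟨γ, hγ, hsmooth, hv, rfl⟩
  refine mem_attractedSubgroup.2 fun U hU => ?_
  obtain ⟨r, hr, hsmall⟩ := exists_forall_oneParameter_mem (E := E) hU
  have hlim : ∀ᶠ t in atTop, ‖exp (t • D) _‖ < r :=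
    (mem_contractingSpace.1 (hW hv)).norm.eventually_lt_const (by simpa using hr)
  have hγ0 : γ 0 = 1 := by simpa using hγ 0 0
  refine hlim.mono fun t ht => ?_
  refine hsmall (fun s => H t (γ s)) (fun s u => by rw [hγ, map_mul]) _
    ((H.contMDiff_apply t).continuous.comp hsmooth.continuous)
    (hasDerivAt_oneChart_comp (H.contMDiff_apply t 1) (by simp)
      hsmooth.continuous.continuousAt hγ0 (hasDerivAt_oneChart_of_mfderiv hsmooth hγ0)) ?_
  rwa [← differential_eq_coordDeriv, hD]

end AutFlow

end Contraction

section Splitting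

open Filter

variable {E : Type*} [NormedAddCommGroup E] [NormedSpace ℝ E] [FiniteDimensional ℝ E]
  {G : Type*} [TopologicalSpace G] [ChartedSpace E G] [Group G] [LieGroup 𝓘(ℝ, E) ∞ G]
  [T2Space G] [IsTopologicalGroup G]

namespace AutFlow

variable {φ H : AutFlow E G} {D : E →L[ℝ] E}

theorem isTopSplit_convergentSubgroup (hD : H.HasDerivation D) :
    IsTopSplit (convergentSubgroup H.toEquiv) (fixedSubgroup H.toEquiv)
      (attractedSubgroup H.toEquiv) where
  left_le := fixedSubgroup_le_convergentSubgroup _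
  disjoint := disjoint_fixedSubgroup_attractedSubgroup _
  subset_mul x hx := by
    obtain ⟨b, hb, a, ha, rfl⟩ := exists_mul_of_mem_convergentSubgroup hx
    exact Set.mul_mem_mul hb ha
  nhdsWithin_le := by
    intro S hS
    obtain ⟨B, hB, A, hA, hBA⟩ := mem_mul.1 hS
    obtain ⟨U, hU, hUB⟩ := mem_nhdsWithin_iff_exists_mem_nhds_inter.1 hB
    obtain ⟨V, hV, hVA⟩ := mem_nhdsWithin_iff_exists_mem_nhds_inter.1 hA
    have hdiv : Tendsto (fun p : G × G => p.1 * p.2⁻¹) (𝓝 1 ×ˢ 𝓝 1) (𝓝 1) := by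
      have hcont : Continuous fun p : G × G => p.1 * p.2⁻¹ := by fun_prop
      simpa only [nhds_prod_eq, inv_one, mul_one] using hcont.tendsto (1, 1)
    obtain ⟨W₁, hW₁, W₂, hW₂, hW⟩ := mem_prod_iff.1 (hdiv hU)
    obtain ⟨r, hr, hsmall⟩ := exists_forall_norm_velocity_lt_mem hD (inter_mem hV hW₂)
    have hvel : ∀ᶠ x in 𝓝 (1 : G), ‖H.velocity x‖ < r :=
      H.continuous_velocity.norm.continuousAt.eventually_lt_const
        (by simpa only [H.velocity_one, norm_zero] using hr)
    filter_upwards [mem_nhdsWithin_of_mem_nhds hW₁, mem_nhdsWithin_of_mem_nhds hvel,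
      self_mem_nhdsWithin] with x hxW hxr hx
    obtain ⟨b, hb, a, ha, rfl⟩ := exists_mul_of_mem_convergentSubgroup hx
    have haVW : a ∈ V ∩ W₂ :=
      hsmall a ha (by rwa [← H.velocity_mul_of_fixed hb])
    have hbU : b ∈ U := by simpa using hW (Set.mk_mem_prod hxW haVW.2)
    exact hBA (Set.mul_mem_mul (hUB ⟨hbU, hb⟩) (hVA ⟨haVW.1, ha⟩))

theorem disjoint_convergentSubgroup_rev_attractedSubgroup (hD : H.HasDerivation D) :
    Disjoint (convergentSubgroup H.rev.toEquiv) (attractedSubgroup H.toEquiv) := by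
  refine Subgroup.disjoint_def.2 fun hrev ha => ?_
  have hconv := attractedSubgroup_le_convergentSubgroup _ ha
  have hfixed := mem_fixedSubgroup_of_velocity_mem
    (velocity_mem_contractingSpace hD hconv) (velocity_mem_contractingSpace_neg hD hrev)
  exact Subgroup.disjoint_def.1 (disjoint_fixedSubgroup_attractedSubgroup _) hfixed ha

theorem isTopSplit_top [LocallyCompactSpace G] [SigmaCompactSpace G] (hD : H.HasDerivation D)
    (hdec : (convergentSubgroup H.rev.toEquiv : Set G) * (attractedSubgroup H.toEquiv : Set G) =
      Set.univ)
    (hdec' : (convergentSubgroup H.toEquiv : Set G) * (attractedSubgroup H.rev.toEquiv : Set G) =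
      Set.univ) :
    IsTopSplit ⊤ (convergentSubgroup H.rev.toEquiv) (attractedSubgroup H.toEquiv) where
  left_le := le_top
  disjoint := disjoint_convergentSubgroup_rev_attractedSubgroup hD
  subset_mul := hdec ▸ Set.subset_univ _
  nhdsWithin_le := by
    have hprod : (convergentSubgroup H.rev.toEquiv : Set G) *
        (convergentSubgroup H.toEquiv : Set G) = Set.univ :=
      Set.univ_subset_iff.1 (hdec ▸ Set.mul_subset_mul_left
        (attractedSubgroup_le_convergentSubgroup H.toEquiv))
    have hfixed : fixedSubgroup H.toEquiv ≤ convergentSubgroup H.rev.toEquiv :=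
      H.fixedSubgroup_rev ▸ fixedSubgroup_le_convergentSubgroup H.rev.toEquiv
    calc 𝓝[((⊤ : Subgroup G) : Set G)] 1 ≤ 𝓝 1 := nhdsWithin_le_nhds
      _ ≤ 𝓝[convergentSubgroup H.rev.toEquiv] 1 * 𝓝[convergentSubgroup H.toEquiv] 1 :=
          nhds_one_le_nhdsWithin_mul_nhdsWithin
            (isClosed_convergentSubgroup hD.rev (by rwa [rev_rev]))
            (isClosed_convergentSubgroup hD hdec) hprod
      _ ≤ 𝓝[convergentSubgroup H.rev.toEquiv] 1 *
            (𝓝[fixedSubgroup H.toEquiv] 1 * 𝓝[attractedSubgroup H.toEquiv] 1) :=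
          mul_le_mul_right (isTopSplit_convergentSubgroup hD).nhdsWithin_le _
      _ ≤ 𝓝[convergentSubgroup H.rev.toEquiv] 1 *
            (𝓝[convergentSubgroup H.rev.toEquiv] 1 * 𝓝[attractedSubgroup H.toEquiv] 1) := by
          gcongr
      _ = 𝓝[convergentSubgroup H.rev.toEquiv] 1 * 𝓝[convergentSubgroup H.rev.toEquiv] 1 *
            𝓝[attractedSubgroup H.toEquiv] 1 := (mul_assoc _ _ _).symm
      _ ≤ 𝓝[convergentSubgroup H.rev.toEquiv] 1 * 𝓝[attractedSubgroup H.toEquiv] 1 := by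
          gcongr
          exact nhdsWithin_one_mul_nhdsWithin_one_le _

theorem chainRecurrentIn_fixedSubgroup [LocallyCompactSpace G] [SigmaCompactSpace G]
    (hD : H.HasDerivation D) (hcomm : ∀ s t g, H s (φ t g) = φ t (H s g))
    (hφ : Tendsto (fun t => ‖(φ.differential t).comp (contractingSpace D).subtypeL‖) atTop (𝓝 0))
    (hφ' : Tendsto (fun t => ‖(φ.rev.differential t).comp (contractingSpace (-D)).subtypeL‖)
      atTop (𝓝 0))
    (hdec : (convergentSubgroup H.rev.toEquiv : Set G) * (attractedSubgroup H.toEquiv : Set G) =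
      Set.univ)
    (hdec' : (convergentSubgroup H.toEquiv : Set G) * (attractedSubgroup H.rev.toEquiv : Set G) =
      Set.univ)
    {a : G} (h : ChainRecurrentIn (fun t => φ t) Set.univ a) :
    ChainRecurrentIn (fun t => φ t) (fixedSubgroup H.toEquiv) a := by
  have hcomm_rev : ∀ s t g, H.rev s (φ t g) = φ t (H.rev s g) := fun s t g => hcomm (-s) t g
  have hmaps : ∀ t, Set.MapsTo (φ t) (convergentSubgroup H.rev.toEquiv)
      (convergentSubgroup H.rev.toEquiv) := fun t x hx =>
    map_mem_convergentSubgroup (f := φ.toEquiv t) (fun s g => hcomm_rev s t g)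
      (φ.contMDiff_apply t).continuous hx
  have hmaps_fixed : ∀ t, Set.MapsTo (φ t) (fixedSubgroup H.rev.toEquiv)
      (fixedSubgroup H.rev.toEquiv) := fun t x hx =>
    map_mem_fixedSubgroup (f := φ.toEquiv t) (fun s g => hcomm_rev s t g) hx
  have hconv : ChainRecurrentIn (fun t => φ t) (convergentSubgroup H.rev.toEquiv) a :=
    .of_contractsToOne (isTopSplit_top hD hdec hdec') hmaps
      (contractsToOne_attractedSubgroup hD hcomm hφ) h
  have hconv_rev : ChainRecurrentIn (fun t => φ.rev t) (convergentSubgroup H.rev.toEquiv) a :=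
    hconv.reverse φ.map_add φ.map_zero_apply φ.continuous_uncurry hmaps
  have hfixed_rev : ChainRecurrentIn (fun t => φ.rev t) (fixedSubgroup H.rev.toEquiv) a :=
    hconv_rev.of_contractsToOne (isTopSplit_convergentSubgroup hD.rev) (fun t => hmaps_fixed (-t))
      (contractsToOne_attractedSubgroup hD.rev (fun s t g => hcomm_rev s (-t) g) hφ')
  have hfixed : ChainRecurrentIn (fun t => φ.rev (-t)) (fixedSubgroup H.rev.toEquiv) a :=
    hfixed_rev.reverse φ.rev.map_add φ.rev.map_zero_apply φ.rev.continuous_uncurry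
      fun t => hmaps_fixed (-t)
  rw [fixedSubgroup_rev] at hfixed
  simpa [rev] using hfixed

end AutFlow

end Splitting

section HyperbolicPart

variable {E : Type*} [NormedAddCommGroup E] [NormedSpace ℝ E]
  {G : Type*} [TopologicalSpace G] [ChartedSpace E G] [Group G] {φ : AutFlow E G}

namespace AutFlow

theorem central_eq_fixedSubgroup (φ : AutFlow E G) :
    φ.central = fixedSubgroup φ.hyperbolicPart.toEquiv := rfl

theorem exists_jordanDecomposition_eq (hJ : Nonempty φ.JordanDecomposition) :
    ∃ J : φ.JordanDecomposition, φ.hyperbolicPart = J.hyp ∧ φ.hyperbolicDerivation = J.hypDer :=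
  ⟨hJ.some, dif_pos hJ, dif_pos hJ⟩

theorem mem_central_of_isEmpty [IsEmpty φ.JordanDecomposition] (g : G) : g ∈ φ.central := by
  intro t
  rw [hyperbolicPart, dif_neg (not_nonempty_iff.2 ‹_›)]
  rfl

variable [FiniteDimensional ℝ E] [LieGroup 𝓘(ℝ, E) ∞ G] [T2Space G] [IsTopologicalGroup G]

theorem stable_le_attractedSubgroup
    (hD : φ.hyperbolicPart.HasDerivation φ.hyperbolicDerivation) :
    φ.stable ≤ attractedSubgroup φ.hyperbolicPart.toEquiv :=
  connectedSubgroup_le_attractedSubgroup hD (stableSpace_le_contractingSpace _)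

theorem unstable_le_attractedSubgroup_rev
    (hD : φ.hyperbolicPart.HasDerivation φ.hyperbolicDerivation) :
    φ.unstable ≤ attractedSubgroup φ.hyperbolicPart.rev.toEquiv :=
  connectedSubgroup_le_attractedSubgroup hD.rev (unstableSpace_le_contractingSpace _)

theorem Decomposes.convergentSubgroup_rev_mul_attractedSubgroup (hφ : φ.Decomposes)
    (hD : φ.hyperbolicPart.HasDerivation φ.hyperbolicDerivation) :
    (convergentSubgroup φ.hyperbolicPart.rev.toEquiv : Set G) *
      (attractedSubgroup φ.hyperbolicPart.toEquiv : Set G) = Set.univ := by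
  refine Set.univ_subset_iff.1 (hφ.1.ge.trans (Set.mul_subset_mul ?_ ?_))
  · rintro _ ⟨u, hu, b, hb, rfl⟩
    rw [central_eq_fixedSubgroup, ← fixedSubgroup_rev] at hb
    exact mul_mem
      (attractedSubgroup_le_convergentSubgroup _ (unstable_le_attractedSubgroup_rev hD hu))
      (fixedSubgroup_le_convergentSubgroup _ hb)
  · exact stable_le_attractedSubgroup hD

theorem Decomposes.convergentSubgroup_mul_attractedSubgroup_rev (hφ : φ.Decomposes)
    (hD : φ.hyperbolicPart.HasDerivation φ.hyperbolicDerivation) :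
    (convergentSubgroup φ.hyperbolicPart.toEquiv : Set G) *
      (attractedSubgroup φ.hyperbolicPart.rev.toEquiv : Set G) = Set.univ := by
  refine Set.univ_subset_iff.1 (hφ.2.ge.trans (Set.mul_subset_mul ?_ ?_))
  · rintro _ ⟨s, hs, b, hb, rfl⟩
    exact mul_mem (attractedSubgroup_le_convergentSubgroup _ (stable_le_attractedSubgroup hD hs))
      (fixedSubgroup_le_convergentSubgroup _ hb)
  · exact unstable_le_attractedSubgroup_rev hD

theorem Decomposes.chainRecurrentIn_central [LocallyCompactSpace G] [SigmaCompactSpace G]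
    (hφ : φ.Decomposes) {a : G} (h : ChainRecurrentIn (fun t => φ t) Set.univ a) :
    ChainRecurrentIn (fun t => φ t) φ.central a := by
  rcases isEmpty_or_nonempty φ.JordanDecomposition with hJ | hJ
  · rwa [Set.eq_univ_of_forall (s := (φ.central : Set G)) mem_central_of_isEmpty]
  obtain ⟨J, hhyp, hder⟩ := exists_jordanDecomposition_eq hJ
  have hD : φ.hyperbolicPart.HasDerivation φ.hyperbolicDerivation := by
    rw [hhyp, hder]
    exact J.hyp_der
  refine chainRecurrentIn_fixedSubgroup hD φ.hyperbolicPart_comm ?_ ?_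
    (hφ.convergentSubgroup_rev_mul_attractedSubgroup hD)
    (hφ.convergentSubgroup_mul_attractedSubgroup_rev hD) h
  · rw [hder]
    exact J.tendsto_norm_differential_comp_subtypeL
  · rw [hder]
    exact J.tendsto_norm_differential_rev_comp_subtypeL

end AutFlow

end HyperbolicPart

end

theorem corollary3p6_general {E : Type*} [NormedAddCommGroup E] [NormedSpace ℝ E]
    [FiniteDimensional ℝ E] {G : Type*} [TopologicalSpace G] [ChartedSpace E G] [Group G]
    [LieGroup 𝓘(ℝ, E) ∞ G] [T2Space G] [SigmaCompactSpace G] (φ : AutFlow E G)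
    (hφ : φ.Decomposes) :
    chainRecurrentSet (fun t => φ t) = Subtype.val '' chainRecurrentSet φ.restrictCentral := by
  have : IsTopologicalGroup G := topologicalGroup_of_lieGroup 𝓘(ℝ, E) ∞
  have : LocallyCompactSpace G := Manifold.locallyCompact_of_finiteDimensional 𝓘(ℝ, E)
  ext a
  rw [mem_chainRecurrentSet_iff, mem_image_chainRecurrentSet_iff (φ := fun t => φ t)
    fun t x => rfl]
  exact ⟨hφ.chainRecurrentIn_central, fun h => h.mono (Set.subset_univ _)⟩

theorem corollary3p6 {E : Type*} [NormedAddCommGroup E] [NormedSpace ℝ E] [FiniteDimensional ℝ E]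
    {G : Type*} [TopologicalSpace G] [ChartedSpace E G] [Group G] [LieGroup 𝓘(ℝ, E) ∞ G]
    [T2Space G] [ConnectedSpace G] (φ : AutFlow E G) (hφ : φ.Decomposes) :
    chainRecurrentSet (fun t => φ t) = Subtype.val '' chainRecurrentSet φ.restrictCentral := by
  have : IsTopologicalGroup G := topologicalGroup_of_lieGroup 𝓘(ℝ, E) ∞
  have : LocallyCompactSpace G := Manifold.locallyCompact_of_finiteDimensional 𝓘(ℝ, E)
  have : SigmaCompactSpace G := sigmaCompactSpace_of_connectedSpace
  exact corollary3p6_general φ hφ
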